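/- Let $k_0>0$ and $r_M>r_s>0$, let $f\in L^2(\mathbb R^2)$ be complex-valued and supported in the disk $\mathcal B_{r_s}=\{\mathbf r\in\mathbb R^2:\|\mathbf r\|<r_s\}$, and let $a\in L^2(\mathbb S^1)$ be complex-valued, where the unit circle $\mathbb S^1\subset\mathbb R^2$ carries its standard line element $ds$. Let $$u^{\mathrm{inc}}(\mathbf r)=\int_{\mathbb S^1}a(\mathbf s)\,e^{ik_0\mathbf r\cdot\mathbf s}\,ds,\qquad u(\mathbf r)=\int_{\mathbb R^2}G(\mathbf r-\mathbf r')f(\mathbf r')u^{\mathrm{inc}}(\mathbf r')\,d\mathbf r',\qquad G(\mathbf r)=\tfrac i4H_0^{(1)}(k_0\|\mathbf r\|),$$ where $H_0^{(1)}=J_0+iY_0$ is the Hankel function of the first kind of order zero; $u$ is the Born approximation of the scattered field. For integrable $\phi$ on $\mathbb R^N$ let $\mathcal F\phi(\mathbf k)=(2\pi)^{-N/2}\int_{\mathbb R^N}\phi(\mathbf r)e^{-i\mathbf k\cdot\mathbf r}\,d\mathbf r$, and for a tempered distribution $w$ on $\mathbb R$ let $\mathcal Fw[\phi]=w[\mathcal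 F\phi]$ for all Schwartz functions $\phi$. For $k\in(-k_0,k_0)$ put $\kappa(k)=\sqrt{k_0^2-k^2}$ and $\mathbf h(k)=(k,\kappa(k))$. Then the integral defining $u$ converges absolutely at every point of the line $\{r_2=r_M\}$, the function $u|_{r_2=r_M}:x\mapsto u(x,r_M)$ belongs to $L^\infty(\mathbb R)$, and its distributional Fourier transform coincides on the open interval $(-k_0,k_0)$ with a continuous function, namely $$\mathcal F\big(u|_{r_2=r_M}\big)(k)=\sqrt{\frac\pi2}\,\frac{i\,e^{i\kappa(k)r_M}}{\kappa(k)}\int_{\mathbb S^1}a(\mathbf s)\,\mathcal Ff\big(\mathbf h(k)-k_0\mathbf s\big)\,ds,\qquad k\in(-k_0,k_0).$$ That is, $\mathcal F(u|_{r_2=r_M})[\phi]$ equals the integral of $\phi$ against the right-hand side for every $\phi\in C_c^\infty(\mathbb R)$ with support in $(-k_0,k_0)$. -/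

import Mathlib

open MeasureTheory Complex
open scoped SchwartzMap ENNReal FourierTransform

noncomputable section

namespace DiffractionTomography

/-- The Euclidean plane. -/
abbrev Plane : Type := EuclideanSpace ℝ (Fin 2)

/-- The unit circle in the Euclidean plane. -/
abbrev Circ : Type := Metric.sphere (0 : Plane) 1

/-- The standard line element (arc length measure, of total mass `2π`) on the unit circle. -/
def arcLength : Measure Circ := (volume : Measure Plane).toSphere

/-- Bessel function of the first kind of order zero. -/
def besselJ0 (x : ℝ) : ℝ :=
  ∑' m : ℕ, (-1) ^ m / (m.factorial : ℝ) ^ 2 * (x / 2) ^ (2 * m)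

/-- Bessel function of the second kind of order zero, for `x > 0`. Here `harmonic m` is
`1 + 1/2 + ⋯ + 1/m`. -/
def besselY0 (x : ℝ) : ℝ :=
  2 / Real.pi * (Real.log (x / 2) + Real.eulerMascheroniConstant) * besselJ0 x
    - 2 / Real.pi *
      ∑' m : ℕ, (-1) ^ m * ((harmonic m : ℚ) : ℝ) / (m.factorial : ℝ) ^ 2 * (x / 2) ^ (2 * m)

/-- Hankel function of the first kind of order zero, for `x > 0`. -/
def hankelH0 (x : ℝ) : ℂ := (besselJ0 x : ℂ) + I * (besselY0 x : ℂ)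

/-- The outgoing fundamental solution `(i/4) H₀⁽¹⁾(k₀ ‖r‖)` of the Helmholtz equation. -/
def outgoingG (k₀ : ℝ) (r : Plane) : ℂ := I / 4 * hankelH0 (k₀ * ‖r‖)

/-- The incident field: the superposition, with beam profile `a`, of the plane waves
`r ↦ exp(i k₀ r·s)`. -/
def incidentField (k₀ : ℝ) (a : Circ → ℂ) (r : Plane) : ℂ :=
  ∫ s : Circ, a s * exp (I * (k₀ * inner ℝ r (s : Plane) : ℝ)) ∂arcLength

/-- The integrand `r' ↦ G(r - r') f(r') u_inc(r')` of the Born approximation at the point `r`. -/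
def bornIntegrand (k₀ : ℝ) (f : Plane → ℂ) (a : Circ → ℂ) (r r' : Plane) : ℂ :=
  outgoingG k₀ (r - r') * f r' * incidentField k₀ a r'

/-- The Born approximation `u` of the scattered field. -/
def bornField (k₀ : ℝ) (f : Plane → ℂ) (a : Circ → ℂ) (r : Plane) : ℂ :=
  ∫ r' : Plane, bornIntegrand k₀ f a r r'

/-- The point of abscissa `x` on the measurement line `{r₂ = r_M}`. -/
def linePoint (rM x : ℝ) : Plane := !₂[x, rM]

/-- The `N`-dimensional Fourier transform `(2π)^(-N/2) ∫ φ(r) exp(-i k·r) dr` of an integrable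
function. -/
def fourierFun {E : Type*} [NormedAddCommGroup E] [InnerProductSpace ℝ E] [FiniteDimensional ℝ E]
    [MeasurableSpace E] [BorelSpace E] (φ : E → ℂ) (k : E) : ℂ :=
  (((2 * Real.pi) ^ (-(Module.finrank ℝ E : ℝ) / 2) : ℝ) : ℂ) *
    ∫ r : E, φ r * exp (-I * (inner ℝ k r : ℝ))

/-- The map `k ↦ k / (2π)`, which relates `fourierFun` on the line to Mathlib's normalization. -/
def dilation : ℝ ≃L[ℝ] ℝ :=
  ContinuousLinearEquiv.unitsEquivAut ℝ
    (Units.mk0 (2 * Real.pi)⁻¹ (inv_ne_zero Real.two_pi_pos.ne'))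

/-- The one-dimensional Fourier transform `fourierFun` as a continuous linear operator on the
Schwartz space, see `schwartzFourier_apply`. -/
def schwartzFourier : 𝓢(ℝ, ℂ) →L[ℂ] 𝓢(ℝ, ℂ) :=
  (((2 * Real.pi) ^ (-(1 : ℝ) / 2) : ℝ) : ℂ) •
    (SchwartzMap.compCLMOfContinuousLinearEquiv ℂ dilation ∘L
      FourierTransform.fourierCLM ℂ 𝓢(ℝ, ℂ))

theorem schwartzFourier_apply (φ : 𝓢(ℝ, ℂ)) (k : ℝ) :
    schwartzFourier φ k = fourierFun (φ : ℝ → ℂ) k := by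
  have h : (FourierTransform.fourier (φ : ℝ → ℂ)) (k * (Real.pi⁻¹ * 2⁻¹)) =
      ∫ r : ℝ, φ r * cexp (-(I * ((r : ℂ) * (k : ℂ)))) := by
    rw [Real.fourier_real_eq_integral_exp_smul]
    refine integral_congr_ae (Filter.Eventually.of_forall fun r => ?_)
    have hpi : (Real.pi : ℂ) ≠ 0 := by exact_mod_cast Real.pi_ne_zero
    simp only [smul_eq_mul]
    rw [mul_comm]
    congr 2
    push_cast
    field_simp
  unfold schwartzFourier fourierFun dilation
  simp [SchwartzMap.fourier_coe, h]

/-- The Fourier transform of tempered distributions on the line: `(𝓕 w)[φ] = w[𝓕 φ]`. -/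
def distFourier (w : 𝓢'(ℝ, ℂ)) : 𝓢'(ℝ, ℂ) :=
  PointwiseConvergenceCLM.precomp ℂ schwartzFourier w

theorem distFourier_apply (w : 𝓢'(ℝ, ℂ)) (φ : 𝓢(ℝ, ℂ)) :
    distFourier w φ = w (schwartzFourier φ) := rfl

/-- On the open set `U`, the distribution `w` is the locally integrable function `g`. -/
def EqFunOn (w : 𝓢'(ℝ, ℂ)) (g : ℝ → ℂ) (U : Set ℝ) : Prop :=
  LocallyIntegrableOn g U ∧
    ∀ φ : 𝓢(ℝ, ℂ), HasCompactSupport (φ : ℝ → ℂ) → tsupport (φ : ℝ → ℂ) ⊆ U →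
      w φ = ∫ k : ℝ, g k * φ k

/-- `κ(k) = √(k₀² - k²)`, for `|k| < k₀`. -/
def kappa (k₀ k : ℝ) : ℝ := Real.sqrt (k₀ ^ 2 - k ^ 2)

/-- The wave vector `h(k) = (k, κ(k))`. -/
def waveVector (k₀ k : ℝ) : Plane := !₂[k, kappa k₀ k]

/-- The right-hand side of the Fourier diffraction relation for beams:
`√(π/2) · i exp(i κ(k) r_M) / κ(k) · ∫ a(s) 𝓕f(h(k) - k₀ s) ds`. -/
def diffractionData (k₀ rM : ℝ) (f : Plane → ℂ) (a : Circ → ℂ) (k : ℝ) : ℂ :=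
  (Real.sqrt (Real.pi / 2) : ℂ) *
    (I * exp (I * (kappa k₀ k * rM : ℝ)) / (kappa k₀ k : ℂ)) *
    ∫ s : Circ, a s * fourierFun f (waveVector k₀ k - k₀ • (s : Plane)) ∂arcLength

end DiffractionTomography

end

open Set Filter Topology

noncomputable section

namespace DiffractionTomography

/-! By Weyl's formula, for `r₂ > 0` the field `G(r)` of a point source is a superposition of
propagating waves `exp(i(k r₁ + κ(k) r₂))`, `|k| < k₀`, with density proportional to `1/κ(k)`, and
of evanescent waves whose horizontal frequency satisfies `|k| ≥ k₀`. Paired with the Fourier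
transform of `φ`, a wave of horizontal frequency `k` gives `√(2π) φ(k)`, so the evanescent waves
disappear when `φ` is supported in `(-k₀, k₀)` (`integral_schwartzFourier_mul_outgoingG`). The
sources lie below the measurement line, so the phase splits as `exp(iκ r_M) exp(-i h(k)·r')`;
integrating against `f u_inc` is a Fourier transform at `h(k)`, and each plane wave of `u_inc`
shifts it by `k₀ s` (`integral_mul_incidentField_mul_exp`). A uniform bound on `G` away from its
singularity (`norm_outgoingG_le`) justifies Fubini and gives boundedness of `u`.

The analytic core is Weyl's formula for a Hankel function given by its series. On the vertical axis
it is an integral representation (`hankelH0_eq`): both sides solve Bessel's equation and have the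
same singular part at the origin, Euler's constant included, so an energy argument (`bessel_unique`)
identifies them. Off the axis, rotating the direction changes the propagating and evanescent
integrals by boundary terms that cancel, so the combination depends on the radius alone
(`propagating_sub_evanescent_rotate`). -/

/-! ### Power series of `J₀`, `Y₀` and Bessel's equation. -/

theorem summable_of_abs_le_div_factorial {c : ℕ → ℝ} {C : ℝ}
    (hc : ∀ m, |c m| ≤ C / (m.factorial : ℝ)) (z : ℝ) : Summable fun m => c m * z ^ m := by
  refine Summable.of_norm_bounded ((Real.summable_pow_div_factorial |z|).mul_left C) fun m => ?_
  rw [norm_mul, norm_pow, Real.norm_eq_abs, Real.norm_eq_abs]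
  calc |c m| * |z| ^ m ≤ C / (m.factorial : ℝ) * |z| ^ m := by gcongr; exact hc m
    _ = _ := by ring

/-- The formal derivative inherits the bound with the same `C`, so termwise differentiation can be
iterated. -/
theorem abs_succ_mul_le_div_factorial {c : ℕ → ℝ} {C : ℝ}
    (hc : ∀ m, |c m| ≤ C / (m.factorial : ℝ)) (m : ℕ) :
    |((m : ℝ) + 1) * c (m + 1)| ≤ C / (m.factorial : ℝ) := by
  have h := hc (m + 1)
  have hm : (0 : ℝ) < (m : ℝ) + 1 := by positivity
  have hf : (0 : ℝ) < (m.factorial : ℝ) := by positivity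
  rw [abs_mul, abs_of_pos hm]
  calc ((m : ℝ) + 1) * |c (m + 1)| ≤ ((m : ℝ) + 1) * (C / ((m + 1).factorial : ℝ)) := by gcongr
    _ = C / (m.factorial : ℝ) := by
      rw [Nat.factorial_succ]; push_cast; field_simp

theorem hasDerivAt_tsum_pow {c : ℕ → ℝ} {C : ℝ}
    (hc : ∀ m, |c m| ≤ C / (m.factorial : ℝ)) (z : ℝ) :
    HasDerivAt (fun z => ∑' m, c m * z ^ m) (∑' m : ℕ, ((m : ℝ) + 1) * c (m + 1) * z ^ m) z := by
  set R : ℝ := |z| + 1 with hR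
  have hR0 : 0 ≤ R := by positivity
  have hsum : Summable fun m : ℕ => |c m| * (m * R ^ (m - 1)) := by
    rw [← summable_nat_add_iff 1]
    refine Summable.of_nonneg_of_le (fun m => by positivity) (fun m => ?_)
      ((Real.summable_pow_div_factorial R).mul_left C)
    have := abs_succ_mul_le_div_factorial hc m
    rw [abs_mul, abs_of_pos (by positivity : (0 : ℝ) < (m : ℝ) + 1)] at this
    calc |c (m + 1)| * (((m + 1 : ℕ) : ℝ) * R ^ (m + 1 - 1))
        = ((m : ℝ) + 1) * |c (m + 1)| * R ^ m := by rw [Nat.add_sub_cancel]; push_cast; ring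
      _ ≤ C / (m.factorial : ℝ) * R ^ m := by gcongr
      _ = _ := by ring
  have hz : z ∈ Metric.ball (0 : ℝ) R := by simp [hR]
  have key := hasDerivAt_tsum_of_isPreconnected (g := fun m z => c m * z ^ m)
    (g' := fun m z => c m * (m * z ^ (m - 1))) hsum Metric.isOpen_ball
    (convex_ball (0 : ℝ) R).isPreconnected
    (fun n y _ => (hasDerivAt_pow n y).const_mul (c n))
    (fun n y hy => by
      have hy' : |y| ≤ R := by
        have := mem_ball_zero_iff.1 hy
        rw [Real.norm_eq_abs] at this
        exact this.le
      rw [norm_mul, norm_mul, norm_pow, Real.norm_eq_abs, Real.norm_eq_abs, Real.norm_eq_abs,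
        Nat.abs_cast]
      gcongr) hz (summable_of_abs_le_div_factorial hc z) hz
  convert! key using 1
  have hs : Summable fun m : ℕ => c m * (m * z ^ (m - 1)) := by
    rw [← summable_nat_add_iff 1]
    refine (summable_of_abs_le_div_factorial (abs_succ_mul_le_div_factorial hc) z).congr
      fun m => ?_
    rw [Nat.add_sub_cancel]; push_cast; ring
  rw [hs.tsum_eq_zero_add]
  simp only [Nat.cast_zero, zero_mul, mul_zero, zero_add, Nat.add_sub_cancel, Nat.cast_add,
    Nat.cast_one]
  exact tsum_congr fun m => by ring

/-- Coefficients of the power series of `J₀` in the variable `(x / 2)²`. -/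
def besselCoeff (m : ℕ) : ℝ := (-1) ^ m / (m.factorial : ℝ) ^ 2

/-- Coefficients of the regular part of `Y₀` in the variable `(x / 2)²`. -/
def besselHarmonicCoeff (m : ℕ) : ℝ := besselCoeff m * ((harmonic m : ℚ) : ℝ)

/-- This recursion is Bessel's equation in the variable `z = (x / 2)²`: `(z A')' = -A`. -/
theorem besselCoeff_succ (m : ℕ) : ((m : ℝ) + 1) ^ 2 * besselCoeff (m + 1) = -besselCoeff m := by
  have hf : (m.factorial : ℝ) ≠ 0 := by positivity
  unfold besselCoeff
  rw [Nat.factorial_succ]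
  push_cast
  field_simp
  ring

theorem abs_besselCoeff (m : ℕ) : |besselCoeff m| = 1 / (m.factorial : ℝ) ^ 2 := by
  unfold besselCoeff
  rw [abs_div, abs_pow, abs_neg, abs_one, one_pow, abs_of_nonneg (by positivity)]

/-- One of the two factorials in the coefficient absorbs the factor `x`; the other gives
convergence. -/
theorem abs_mul_besselCoeff_le {x : ℝ} {m : ℕ} (hx : |x| ≤ (m.factorial : ℝ)) :
    |x * besselCoeff m| ≤ 1 / (m.factorial : ℝ) := by
  have hf : (0 : ℝ) < (m.factorial : ℝ) := by positivity
  rw [abs_mul, abs_besselCoeff, mul_one_div, div_le_div_iff₀ (by positivity) hf]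
  nlinarith

theorem harmonic_le_self (m : ℕ) : ((harmonic m : ℚ) : ℝ) ≤ m := by
  have : harmonic m ≤ (m : ℚ) := by
    unfold harmonic
    calc ∑ i ∈ Finset.range m, ((i + 1 : ℕ) : ℚ)⁻¹ ≤ ∑ i ∈ Finset.range m, (1 : ℚ) := by
          refine Finset.sum_le_sum fun i _ => ?_
          exact inv_le_one_of_one_le₀ (by push_cast; linarith [(Nat.cast_nonneg i : (0 : ℚ) ≤ i)])
      _ = m := by simp
  exact_mod_cast this

theorem harmonic_nonneg (m : ℕ) : 0 ≤ ((harmonic m : ℚ) : ℝ) := by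
  have : 0 ≤ harmonic m := Finset.sum_nonneg fun i _ => by positivity
  exact_mod_cast this

theorem abs_besselCoeff_le (m : ℕ) : |besselCoeff m| ≤ 1 / (m.factorial : ℝ) := by
  simpa using abs_mul_besselCoeff_le (x := 1) (m := m)
    (by rw [abs_one]; exact_mod_cast m.factorial_pos)

theorem abs_besselHarmonicCoeff_le (m : ℕ) :
    |besselHarmonicCoeff m| ≤ 1 / (m.factorial : ℝ) := by
  rw [besselHarmonicCoeff, mul_comm]
  refine abs_mul_besselCoeff_le ?_
  rw [abs_of_nonneg (harmonic_nonneg m)]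
  exact (harmonic_le_self m).trans (by exact_mod_cast m.self_le_factorial)

theorem abs_natCast_mul_besselCoeff_le (m : ℕ) :
    |(m : ℝ) * besselCoeff m| ≤ 1 / (m.factorial : ℝ) :=
  abs_mul_besselCoeff_le (by rw [Nat.abs_cast]; exact_mod_cast m.self_le_factorial)

theorem sq_le_two_mul_factorial (m : ℕ) : m ^ 2 ≤ 2 * m.factorial := by
  induction m with
  | zero => simp
  | succ k ih =>
    rw [Nat.factorial_succ]
    have h1 := k.factorial_pos
    have h2 := k.self_le_factorial
    rcases Nat.lt_or_ge k 1 with h | h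
    · interval_cases k; simp
    · nlinarith

theorem abs_natCast_mul_besselHarmonicCoeff_le (m : ℕ) :
    |(m : ℝ) * besselHarmonicCoeff m| ≤ 2 / (m.factorial : ℝ) := by
  have h := sq_le_two_mul_factorial m
  have h' : (m : ℝ) ^ 2 ≤ 2 * (m.factorial : ℝ) := by exact_mod_cast h
  have h2 := abs_mul_besselCoeff_le (x := (m : ℝ) * ((harmonic m : ℚ) : ℝ) / 2) (m := m) (by
    rw [abs_of_nonneg (by have := harmonic_nonneg m; positivity)]
    nlinarith [harmonic_le_self m, harmonic_nonneg m, (Nat.cast_nonneg m : (0 : ℝ) ≤ m)])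
  have h3 : (m : ℝ) * besselHarmonicCoeff m
      = 2 * ((m : ℝ) * ((harmonic m : ℚ) : ℝ) / 2 * besselCoeff m) := by
    unfold besselHarmonicCoeff; ring
  rw [h3, abs_mul, abs_of_pos (two_pos : (0 : ℝ) < 2)]
  calc _ ≤ 2 * (1 / (m.factorial : ℝ)) := by gcongr
    _ = _ := by ring

/-- `J₀` as a power series in `z = (x / 2)²`. -/
def besselSeries (z : ℝ) : ℝ := ∑' m, besselCoeff m * z ^ m

/-- The derivative of `besselSeries`. -/
def besselSeriesDeriv (z : ℝ) : ℝ := ∑' m : ℕ, ((m : ℝ) + 1) * besselCoeff (m + 1) * z ^ m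

/-- The regular part of `Y₀` as a power series in `z = (x / 2)²`. -/
def harmonicSeries (z : ℝ) : ℝ := ∑' m, besselHarmonicCoeff m * z ^ m

/-- The derivative of `harmonicSeries`. -/
def harmonicSeriesDeriv (z : ℝ) : ℝ :=
  ∑' m : ℕ, ((m : ℝ) + 1) * besselHarmonicCoeff (m + 1) * z ^ m

theorem hasDerivAt_besselSeries (z : ℝ) : HasDerivAt besselSeries (besselSeriesDeriv z) z :=
  hasDerivAt_tsum_pow abs_besselCoeff_le z

theorem hasDerivAt_harmonicSeries (z : ℝ) :
    HasDerivAt harmonicSeries (harmonicSeriesDeriv z) z :=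
  hasDerivAt_tsum_pow abs_besselHarmonicCoeff_le z

theorem continuous_besselSeriesDeriv : Continuous besselSeriesDeriv :=
  continuous_iff_continuousAt.2 fun z => (hasDerivAt_tsum_pow
    (abs_succ_mul_le_div_factorial abs_besselCoeff_le) z).continuousAt

theorem continuous_harmonicSeriesDeriv : Continuous harmonicSeriesDeriv :=
  continuous_iff_continuousAt.2 fun z => (hasDerivAt_tsum_pow
    (abs_succ_mul_le_div_factorial abs_besselHarmonicCoeff_le) z).continuousAt

/-- Multiplication by `z` turns the differentiated series into `∑ m c_m z^m`, again a power series
to which `hasDerivAt_tsum_pow` applies. -/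
theorem mul_tsum_succ_eq {c : ℕ → ℝ} {C : ℝ} (hc : ∀ m : ℕ, |(m : ℝ) * c m| ≤ C / (m.factorial : ℝ))
    (z : ℝ) : z * ∑' m : ℕ, ((m : ℝ) + 1) * c (m + 1) * z ^ m = ∑' m : ℕ, (m : ℝ) * c m * z ^ m := by
  rw [(summable_of_abs_le_div_factorial hc z).tsum_eq_zero_add, ← tsum_mul_left]
  simp only [Nat.cast_zero, zero_mul, zero_add, Nat.cast_add, Nat.cast_one]
  exact tsum_congr fun m => by ring

theorem hasDerivAt_mul_besselSeriesDeriv (z : ℝ) :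
    HasDerivAt (fun z => z * besselSeriesDeriv z) (-besselSeries z) z := by
  have h := hasDerivAt_tsum_pow abs_natCast_mul_besselCoeff_le z
  simp_rw [besselSeriesDeriv, mul_tsum_succ_eq abs_natCast_mul_besselCoeff_le]
  convert! h using 1
  rw [besselSeries, ← tsum_neg]
  refine tsum_congr fun m => ?_
  have := besselCoeff_succ m
  push_cast
  linear_combination -(z ^ m) * this

/-- The source term `A'` comes from `H_{m+1} = H_m + 1/(m+1)`. In `Y₀` it cancels the cross terms
produced by differentiating the logarithm. -/
theorem hasDerivAt_mul_harmonicSeriesDeriv (z : ℝ) :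
    HasDerivAt (fun z => z * harmonicSeriesDeriv z) (besselSeriesDeriv z - harmonicSeries z) z := by
  have h := hasDerivAt_tsum_pow abs_natCast_mul_besselHarmonicCoeff_le z
  simp_rw [harmonicSeriesDeriv, mul_tsum_succ_eq abs_natCast_mul_besselHarmonicCoeff_le]
  convert! h using 1
  rw [besselSeriesDeriv, harmonicSeries, ← Summable.tsum_sub
    (summable_of_abs_le_div_factorial (abs_succ_mul_le_div_factorial abs_besselCoeff_le) z)
    (summable_of_abs_le_div_factorial abs_besselHarmonicCoeff_le z)]
  refine tsum_congr fun m => ?_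
  have := besselCoeff_succ m
  have hm : (m : ℝ) + 1 ≠ 0 := by positivity
  unfold besselHarmonicCoeff
  rw [harmonic_succ]
  push_cast
  field_simp
  linear_combination -(z ^ m) * ((harmonic m : ℚ) : ℝ) * this

theorem besselSeries_zero : besselSeries 0 = 1 := by
  rw [besselSeries, tsum_eq_single 0 (fun m hm => by simp [hm])]
  simp [besselCoeff]

theorem harmonicSeries_zero : harmonicSeries 0 = 0 := by
  rw [harmonicSeries, tsum_eq_single 0 (fun m hm => by simp [hm])]
  simp [besselHarmonicCoeff]

theorem besselJ0_eq (x : ℝ) : besselJ0 x = besselSeries ((x / 2) ^ 2) := by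
  unfold besselJ0 besselSeries besselCoeff
  simp_rw [pow_mul]

theorem besselY0_eq (x : ℝ) : besselY0 x =
    2 / Real.pi * ((Real.log (x / 2) + Real.eulerMascheroniConstant) * besselSeries ((x / 2) ^ 2)
      - harmonicSeries ((x / 2) ^ 2)) := by
  have : harmonicSeries ((x / 2) ^ 2) =
      ∑' m : ℕ, (-1) ^ m * ((harmonic m : ℚ) : ℝ) / (m.factorial : ℝ) ^ 2 * (x / 2) ^ (2 * m) := by
    unfold harmonicSeries besselHarmonicCoeff besselCoeff
    simp_rw [pow_mul]
    exact tsum_congr fun m => by ring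
  rw [besselY0, besselJ0_eq, this]
  ring

theorem continuous_besselSeries : Continuous besselSeries :=
  continuous_iff_continuousAt.2 fun z => (hasDerivAt_besselSeries z).continuousAt

theorem continuous_harmonicSeries : Continuous harmonicSeries :=
  continuous_iff_continuousAt.2 fun z => (hasDerivAt_harmonicSeries z).continuousAt

theorem measurable_hankelH0 : Measurable hankelH0 := by
  have h1 : Measurable besselJ0 := by
    rw [show besselJ0 = fun x => besselSeries ((x / 2) ^ 2) from funext besselJ0_eq]
    exact (continuous_besselSeries.comp (by fun_prop)).measurable
  have h2 : Measurable besselY0 := by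
    rw [show besselY0 = _ from funext besselY0_eq]
    have a1 : Measurable fun x : ℝ => besselSeries ((x / 2) ^ 2) :=
      (continuous_besselSeries.comp (by fun_prop)).measurable
    have a2 : Measurable fun x : ℝ => harmonicSeries ((x / 2) ^ 2) :=
      (continuous_harmonicSeries.comp (by fun_prop)).measurable
    have a3 : Measurable fun x : ℝ => Real.log (x / 2) :=
      Real.measurable_log.comp (by fun_prop)
    fun_prop
  unfold hankelH0
  fun_prop

/-- `x J₀'(x)`. -/
def besselJ0Flux (x : ℝ) : ℝ := 2 * ((x / 2) ^ 2 * besselSeriesDeriv ((x / 2) ^ 2))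

/-- `x Y₀'(x)`. -/
def besselY0Flux (x : ℝ) : ℝ :=
  2 / Real.pi * (besselSeries ((x / 2) ^ 2)
    + (Real.log (x / 2) + Real.eulerMascheroniConstant) * besselJ0Flux x
    - 2 * ((x / 2) ^ 2 * harmonicSeriesDeriv ((x / 2) ^ 2)))

theorem hasDerivAt_half_sq (x : ℝ) : HasDerivAt (fun x : ℝ => (x / 2) ^ 2) (x / 2) x := by
  have := ((hasDerivAt_id x).div_const 2).pow 2
  convert! this using 1
  simp; ring

/-- Bessel's equation is carried as the first-order system `U' = P/x`, `P' = -xU` with flux `P =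
xU'`. -/
theorem hasDerivAt_besselJ0 {x : ℝ} (hx : 0 < x) :
    HasDerivAt besselJ0 (besselJ0Flux x / x) x := by
  rw [show besselJ0 = fun x => besselSeries ((x / 2) ^ 2) from funext besselJ0_eq]
  have := (hasDerivAt_besselSeries ((x / 2) ^ 2)).comp x (hasDerivAt_half_sq x)
  convert! this using 1
  unfold besselJ0Flux
  field_simp

theorem hasDerivAt_besselJ0Flux (x : ℝ) :
    HasDerivAt besselJ0Flux (-(x * besselJ0 x)) x := by
  have := ((hasDerivAt_mul_besselSeriesDeriv ((x / 2) ^ 2)).comp x (hasDerivAt_half_sq x)).const_mul 2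
  convert! this using 1
  rw [besselJ0_eq]
  ring

theorem hasDerivAt_log_half {x : ℝ} (hx : 0 < x) :
    HasDerivAt (fun x => Real.log (x / 2) + Real.eulerMascheroniConstant) (1 / x) x := by
  have := (((hasDerivAt_id x).div_const 2).log (by simp [hx.ne'])).add_const
    Real.eulerMascheroniConstant
  convert! this using 1
  simp; field_simp

theorem hasDerivAt_besselY0 {x : ℝ} (hx : 0 < x) :
    HasDerivAt besselY0 (besselY0Flux x / x) x := by
  rw [show besselY0 = _ from funext besselY0_eq]
  have h1 := (hasDerivAt_besselSeries ((x / 2) ^ 2)).comp x (hasDerivAt_half_sq x)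
  have h2 := (hasDerivAt_harmonicSeries ((x / 2) ^ 2)).comp x (hasDerivAt_half_sq x)
  have := (((hasDerivAt_log_half hx).mul h1).sub h2).const_mul (2 / Real.pi)
  convert! this using 1
  unfold besselY0Flux besselJ0Flux
  simp only [Function.comp]
  field_simp

theorem hasDerivAt_besselY0Flux {x : ℝ} (hx : 0 < x) :
    HasDerivAt besselY0Flux (-(x * besselY0 x)) x := by
  have h1 := (hasDerivAt_besselSeries ((x / 2) ^ 2)).comp x (hasDerivAt_half_sq x)
  have h2 := ((hasDerivAt_mul_harmonicSeriesDeriv ((x / 2) ^ 2)).comp x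
    (hasDerivAt_half_sq x)).const_mul 2
  have := ((h1.add ((hasDerivAt_log_half hx).mul (hasDerivAt_besselJ0Flux x))).sub h2).const_mul
    (2 / Real.pi)
  convert! this using 1
  rw [besselY0_eq, besselJ0_eq]
  unfold besselJ0Flux
  field_simp
  ring

/-- `x H₀'(x)`. -/
def hankelFlux (x : ℝ) : ℂ := (besselJ0Flux x : ℂ) + I * (besselY0Flux x : ℂ)

theorem hasDerivAt_hankelH0 {x : ℝ} (hx : 0 < x) :
    HasDerivAt hankelH0 (hankelFlux x / x) x := by
  have := (hasDerivAt_besselJ0 hx).ofReal_comp.add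
    ((hasDerivAt_besselY0 hx).ofReal_comp.const_mul I)
  convert! this using 1
  unfold hankelFlux
  push_cast
  ring

theorem hasDerivAt_hankelFlux {x : ℝ} (hx : 0 < x) :
    HasDerivAt hankelFlux (-(x * hankelH0 x)) x := by
  have := (hasDerivAt_besselJ0Flux x).ofReal_comp.add
    ((hasDerivAt_besselY0Flux hx).ofReal_comp.const_mul I)
  convert! this using 1
  unfold hankelH0
  push_cast
  ring

/-! ### Behaviour at the origin and uniqueness for Bessel's equation. -/

theorem tendsto_log_half_mul_self :
    Tendsto (fun x : ℝ => (Real.log (x / 2) + Real.eulerMascheroniConstant) * x) (𝓝[>] 0) (𝓝 0) := by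
  have h1 : Tendsto (fun x : ℝ => Real.log x * x) (𝓝[>] 0) (𝓝 0) := by
    simpa using tendsto_log_mul_rpow_nhdsGT_zero (r := 1) one_pos
  have h2 : Tendsto (fun x : ℝ => (Real.eulerMascheroniConstant - Real.log 2) * x) (𝓝[>] 0)
      (𝓝 0) := by
    have : Continuous fun x : ℝ => (Real.eulerMascheroniConstant - Real.log 2) * x := by fun_prop
    simpa using (this.tendsto 0).mono_left nhdsWithin_le_nhds
  have h3 := h1.add h2
  rw [add_zero] at h3
  refine h3.congr' ?_
  filter_upwards [self_mem_nhdsWithin] with x hx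
  rw [Real.log_div (ne_of_gt hx) two_ne_zero]
  ring

theorem tendsto_comp_half_sq {g : ℝ → ℝ} (hg : Continuous g) :
    Tendsto (fun x : ℝ => g ((x / 2) ^ 2)) (𝓝[>] 0) (𝓝 (g 0)) := by
  have : Continuous fun x : ℝ => g ((x / 2) ^ 2) := by fun_prop
  simpa using (this.tendsto 0).mono_left nhdsWithin_le_nhds

/-- The quotient is the slope of `J₀` at `0`, where the derivative vanishes. Hence `J₀ - 1 = o(x)`,
enough to beat the logarithm. -/
theorem tendsto_besselSeries_sub_one_div :
    Tendsto (fun x : ℝ => (besselSeries ((x / 2) ^ 2) - 1) / x) (𝓝[>] 0) (𝓝 0) := by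
  have := (hasDerivAt_besselSeries ((0 / 2) ^ 2)).comp (0 : ℝ) (hasDerivAt_half_sq 0)
  rw [hasDerivAt_iff_tendsto_slope] at this
  have h2 := this.mono_left (nhdsWithin_mono _ (fun x (hx : 0 < x) => hx.ne'))
  simp only [zero_div, mul_zero] at h2
  refine h2.congr fun x => ?_
  simp [slope_def_field, besselSeries_zero]

/-- The singular part at the origin of `H₀`. -/
def hankelSing (x : ℝ) : ℂ :=
  1 + I * ((2 / Real.pi * (Real.log (x / 2) + Real.eulerMascheroniConstant) : ℝ) : ℂ)

theorem tendsto_hankelH0_sub_sing :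
    Tendsto (fun x => hankelH0 x - hankelSing x) (𝓝[>] 0) (𝓝 0) := by
  have hJ : Tendsto (fun x : ℝ => besselSeries ((x / 2) ^ 2) - 1) (𝓝[>] 0) (𝓝 0) := by
    simpa [besselSeries_zero] using (tendsto_comp_half_sq continuous_besselSeries).sub_const 1
  have hB : Tendsto (fun x : ℝ => harmonicSeries ((x / 2) ^ 2)) (𝓝[>] 0) (𝓝 0) := by
    simpa [harmonicSeries_zero] using tendsto_comp_half_sq continuous_harmonicSeries
  -- With `L` the logarithmic factor, `L (J₀ - 1)` is written as `(L x) · ((J₀ - 1) / x)`.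
  have hL := tendsto_log_half_mul_self.mul tendsto_besselSeries_sub_one_div
  rw [mul_zero] at hL
  have hY := (hL.sub hB).const_mul (2 / Real.pi)
  have := (hJ.ofReal).add ((hY.ofReal).const_mul I)
  simp only [sub_zero, mul_zero, Complex.ofReal_zero, add_zero] at this
  refine this.congr' ?_
  filter_upwards [self_mem_nhdsWithin] with x hx
  have hx' : (x : ℂ) ≠ 0 := by exact_mod_cast (ne_of_gt hx)
  rw [hankelH0, hankelSing, besselY0_eq, besselJ0_eq]
  push_cast
  field_simp
  ring

/-- The subtracted term is the derivative of `hankelSing`; uniqueness needs the derivative to match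
at the origin as well as the value. -/
theorem tendsto_hankelFlux_div_sub :
    Tendsto (fun x : ℝ => hankelFlux x / x - I * ((2 / (Real.pi * x) : ℝ) : ℂ)) (𝓝[>] 0) (𝓝 0) := by
  have hid : Tendsto (fun x : ℝ => x) (𝓝[>] 0) (𝓝 0) := nhdsWithin_le_nhds
  have hA := tendsto_comp_half_sq continuous_besselSeriesDeriv
  have hB := tendsto_comp_half_sq continuous_harmonicSeriesDeriv
  have hJ : Tendsto (fun x : ℝ => x / 2 * besselSeriesDeriv ((x / 2) ^ 2)) (𝓝[>] 0) (𝓝 0) := by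
    simpa using (hid.div_const 2).mul hA
  have hB2 : Tendsto (fun x : ℝ => x / 2 * harmonicSeriesDeriv ((x / 2) ^ 2)) (𝓝[>] 0) (𝓝 0) := by
    simpa using (hid.div_const 2).mul hB
  have hL : Tendsto (fun x : ℝ => (Real.log (x / 2) + Real.eulerMascheroniConstant) * x *
      (1 / 2 * besselSeriesDeriv ((x / 2) ^ 2))) (𝓝[>] 0) (𝓝 0) := by
    have := tendsto_log_half_mul_self.mul (hA.const_mul (1 / 2))
    rwa [zero_mul] at this
  have hY := ((tendsto_besselSeries_sub_one_div.add hL).sub hB2).const_mul (2 / Real.pi)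
  have := (hJ.ofReal).add ((hY.ofReal).const_mul I)
  simp only [sub_zero, mul_zero, Complex.ofReal_zero, add_zero] at this
  refine this.congr' ?_
  filter_upwards [self_mem_nhdsWithin] with x hx
  have hx' : (x : ℂ) ≠ 0 := by exact_mod_cast (ne_of_gt hx)
  have hpi : (Real.pi : ℂ) ≠ 0 := by exact_mod_cast Real.pi_ne_zero
  rw [hankelFlux, besselY0Flux, besselJ0Flux]
  push_cast
  field_simp
  ring

/-- Uniqueness for Bessel's equation of order zero with vanishing data at the origin. -/
theorem bessel_unique_real {U P : ℝ → ℝ} (hU : ∀ x > 0, HasDerivAt U (P x / x) x)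
    (hP : ∀ x > 0, HasDerivAt P (-(x * U x)) x) (hU0 : Tendsto U (𝓝[>] 0) (𝓝 0))
    (hP0 : Tendsto (fun x => P x / x) (𝓝[>] 0) (𝓝 0)) {x : ℝ} (hx : 0 < x) : U x = 0 := by
  -- The energy `U² + U'²` has derivative `-2U'²/x ≤ 0` and tends to `0` at the origin, so it is
  -- nowhere positive.
  set E : ℝ → ℝ := fun x => U x ^ 2 + (P x / x) ^ 2 with hE
  have hd : ∀ x > 0, HasDerivAt E (-(2 * (P x) ^ 2 / x ^ 3)) x := fun x hx => by
    have := ((hU x hx).pow 2).add (((hP x hx).div (hasDerivAt_id x) hx.ne').pow 2)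
    convert! this using 1
    have := hx.ne'
    simp
    field_simp
    ring
  have hanti : AntitoneOn E (Ioi 0) := by
    refine antitoneOn_of_deriv_nonpos (convex_Ioi 0)
      (fun y hy => (hd y hy).continuousAt.continuousWithinAt)
      (fun y hy => ((hd y (by simpa using hy)).differentiableAt).differentiableWithinAt)
      fun y hy => ?_
    rw [interior_Ioi] at hy
    have hy' : 0 < y := hy
    rw [(hd y hy).deriv]
    have : 0 ≤ 2 * (P y) ^ 2 / y ^ 3 := by positivity
    linarith
  have hE0 : Tendsto E (𝓝[>] 0) (𝓝 0) := by
    simpa using (hU0.pow 2).add (hP0.pow 2)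
  have hle : E x ≤ 0 := by
    refine ge_of_tendsto hE0 ?_
    filter_upwards [Ioo_mem_nhdsGT hx] with y hy
    exact hanti hy.1 hx hy.2.le
  have : U x ^ 2 ≤ 0 := by
    have := sq_nonneg (P x / x)
    simp only [hE] at hle
    linarith
  exact pow_eq_zero_iff (two_ne_zero) |>.1 (le_antisymm this (sq_nonneg _))

theorem bessel_unique {U P : ℝ → ℂ} (hU : ∀ x > 0, HasDerivAt U (P x / x) x)
    (hP : ∀ x > 0, HasDerivAt P (-(x * U x)) x) (hU0 : Tendsto U (𝓝[>] 0) (𝓝 0))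
    (hP0 : Tendsto (fun x => P x / x) (𝓝[>] 0) (𝓝 0)) {x : ℝ} (hx : 0 < x) : U x = 0 := by
  apply Complex.ext
  · refine bessel_unique_real (U := fun x => (U x).re) (P := fun x => (P x).re)
      (fun y hy => ?_) (fun y hy => ?_) ?_ ?_ hx
    · exact (Complex.reCLM.hasFDerivAt.comp_hasDerivAt y (hU y hy)).congr_deriv (by simp)
    · exact (Complex.reCLM.hasFDerivAt.comp_hasDerivAt y (hP y hy)).congr_deriv (by simp)
    · simpa [Function.comp_def] using (Complex.continuous_re.tendsto _).comp hU0
    · simpa [Function.comp_def] using (Complex.continuous_re.tendsto _).comp hP0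
  · refine bessel_unique_real (U := fun x => (U x).im) (P := fun x => (P x).im)
      (fun y hy => ?_) (fun y hy => ?_) ?_ ?_ hx
    · exact (Complex.imCLM.hasFDerivAt.comp_hasDerivAt y (hU y hy)).congr_deriv (by simp)
    · exact (Complex.imCLM.hasFDerivAt.comp_hasDerivAt y (hP y hy)).congr_deriv (by simp)
    · simpa [Function.comp_def] using (Complex.continuous_im.tendsto _).comp hU0
    · simpa [Function.comp_def] using (Complex.continuous_im.tendsto _).comp hP0

/-! ### Laplace-type integrals of `exp(-r sinh t)`. -/

theorem tendsto_sinh_atTop : Tendsto Real.sinh atTop atTop :=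
  tendsto_atTop_mono' _ ((eventually_ge_atTop 0).mono fun _ hx => Real.self_le_sinh_iff.2 hx)
    tendsto_id

theorem tendsto_exp_neg_mul_sinh {c : ℝ} (hc : 0 < c) :
    Tendsto (fun t => Real.exp (-(c * Real.sinh t))) atTop (𝓝 0) :=
  Real.tendsto_exp_neg_atTop_nhds_zero.comp (tendsto_sinh_atTop.const_mul_atTop hc)

theorem hasDerivAt_exp_neg_mul_sinh (c t : ℝ) :
    HasDerivAt (fun t => Real.exp (-(c * Real.sinh t)))
      (-(c * (Real.cosh t * Real.exp (-(c * Real.sinh t))))) t := by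
  have := (((Real.hasDerivAt_sinh t).const_mul c).neg).exp
  exact this.congr_deriv (by simp only [Pi.neg_apply]; ring)

/-- The integrand has the explicit primitive `-exp(-c sinh t) / c`; the other integrability
statements follow by domination. -/
theorem integrableOn_cosh_mul_exp {c : ℝ} (hc : 0 < c) :
    IntegrableOn (fun t => Real.cosh t * Real.exp (-(c * Real.sinh t))) (Ioi 0) := by
  have := integrableOn_Ioi_deriv_of_nonpos' (a := 0)
    (fun t _ => hasDerivAt_exp_neg_mul_sinh c t)
    (fun t _ => by
      have := Real.cosh_pos t
      rw [neg_nonpos]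
      positivity) (tendsto_exp_neg_mul_sinh hc)
  have h2 := Integrable.const_mul this (-c⁻¹)
  refine (h2.congr (Eventually.of_forall fun t => ?_))
  field_simp

theorem integral_cosh_mul_exp {c : ℝ} (hc : 0 < c) :
    ∫ t in Ioi 0, Real.cosh t * Real.exp (-(c * Real.sinh t)) = 1 / c := by
  have := integral_Ioi_of_hasDerivAt_of_tendsto' (a := 0)
    (fun t _ => hasDerivAt_exp_neg_mul_sinh c t)
    (((integrableOn_cosh_mul_exp hc).const_mul c).neg) (tendsto_exp_neg_mul_sinh hc)
  rw [integral_neg, integral_const_mul] at this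
  simp at this
  field_simp
  linarith

theorem integrableOn_exp_neg_sinh {c : ℝ} (hc : 0 < c) :
    IntegrableOn (fun t => Real.exp (-(c * Real.sinh t))) (Ioi 0) := by
  refine Integrable.mono' (integrableOn_cosh_mul_exp hc) (by fun_prop)
    (Eventually.of_forall fun t => ?_)
  rw [Real.norm_eq_abs, Real.abs_exp]
  exact le_mul_of_one_le_left (Real.exp_pos _).le (Real.one_le_cosh t)

theorem cosh_le_one_add_sinh {t : ℝ} (ht : 0 ≤ t) : Real.cosh t ≤ 1 + Real.sinh t := by
  have := Real.cosh_sub_sinh t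
  have h2 : Real.exp (-t) ≤ 1 := Real.exp_le_one_iff.2 (by linarith)
  linarith

theorem integrableOn_cosh_sq_mul_exp {c : ℝ} (hc : 0 < c) :
    IntegrableOn (fun t => Real.cosh t ^ 2 * Real.exp (-(c * Real.sinh t))) (Ioi 0) := by
  -- Half of the exponent absorbs one `cosh`: `cosh t ≤ 1 + (2/c)(c/2 · sinh t) ≤ (1 + 2/c) exp(c/2
  -- · sinh t)`.
  refine Integrable.mono' ((integrableOn_cosh_mul_exp (half_pos hc)).const_mul (1 + 2 / c))
    (by fun_prop) ?_
  filter_upwards [ae_restrict_mem measurableSet_Ioi] with t ht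
  have ht' : 0 ≤ t := le_of_lt ht
  have hs : 0 ≤ Real.sinh t := Real.sinh_nonneg_iff.2 ht'
  have h1 := cosh_le_one_add_sinh ht'
  have h2 := Real.add_one_le_exp (c / 2 * Real.sinh t)
  have h3 : Real.cosh t ≤ (1 + 2 / c) * Real.exp (c / 2 * Real.sinh t) := by
    have e1 : Real.sinh t = 2 / c * (c / 2 * Real.sinh t) := by field_simp
    have e2 : 0 ≤ c / 2 * Real.sinh t := by positivity
    have e3 : 2 / c * (c / 2 * Real.sinh t) ≤ 2 / c * Real.exp (c / 2 * Real.sinh t) := by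
      gcongr; linarith
    nlinarith
  have h4 : Real.exp (-(c * Real.sinh t)) =
      Real.exp (-(c / 2 * Real.sinh t)) * Real.exp (-(c / 2 * Real.sinh t)) := by
    rw [← Real.exp_add]; congr 1; ring
  have h5 : Real.exp (c / 2 * Real.sinh t) * Real.exp (-(c / 2 * Real.sinh t)) = 1 := by
    rw [← Real.exp_add]; simp
  have hcosh := Real.cosh_pos t
  rw [Real.norm_eq_abs, abs_of_nonneg (by positivity), h4]
  set E := Real.exp (-(c / 2 * Real.sinh t))
  have hE : 0 < E := Real.exp_pos _
  calc Real.cosh t ^ 2 * (E * E) = Real.cosh t * (Real.cosh t * E * E) := by ring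
    _ ≤ Real.cosh t * ((1 + 2 / c) * Real.exp (c / 2 * Real.sinh t) * E * E) := by gcongr
    _ = Real.cosh t * (1 + 2 / c) * E * (Real.exp (c / 2 * Real.sinh t) * E) := by ring
    _ = _ := by rw [h5]; ring

theorem integrableOn_sinh_mul_exp {c : ℝ} (hc : 0 < c) :
    IntegrableOn (fun t => Real.sinh t * Real.exp (-(c * Real.sinh t))) (Ioi 0) := by
  refine Integrable.mono' (integrableOn_cosh_mul_exp hc) (by fun_prop) ?_
  filter_upwards [ae_restrict_mem measurableSet_Ioi] with t ht
  have hs : 0 ≤ Real.sinh t := Real.sinh_nonneg_iff.2 (le_of_lt ht)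
  rw [Real.norm_eq_abs, abs_of_nonneg (by positivity)]
  gcongr
  exact (Real.sinh_lt_cosh t).le

theorem integrableOn_sinh_sq_mul_exp {c : ℝ} (hc : 0 < c) :
    IntegrableOn (fun t => Real.sinh t ^ 2 * Real.exp (-(c * Real.sinh t))) (Ioi 0) := by
  refine Integrable.mono' (integrableOn_cosh_sq_mul_exp hc) (by fun_prop) ?_
  filter_upwards [ae_restrict_mem measurableSet_Ioi] with t ht
  have hs : 0 ≤ Real.sinh t := Real.sinh_nonneg_iff.2 (le_of_lt ht)
  rw [Real.norm_eq_abs, abs_of_nonneg (by positivity)]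
  gcongr
  exact (Real.sinh_lt_cosh t).le

/-- `∫₀^∞ e^{-r sinh t} dt`. -/
def sinhLaplace (r : ℝ) : ℝ := ∫ t in Ioi 0, Real.exp (-(r * Real.sinh t))

/-- `∫₀^∞ sinh t e^{-r sinh t} dt`. -/
def sinhLaplace₁ (r : ℝ) : ℝ := ∫ t in Ioi 0, Real.sinh t * Real.exp (-(r * Real.sinh t))

/-- `∫₀^∞ sinh² t e^{-r sinh t} dt`. -/
def sinhLaplace₂ (r : ℝ) : ℝ := ∫ t in Ioi 0, Real.sinh t ^ 2 * Real.exp (-(r * Real.sinh t))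

theorem hasDerivAt_sinhLaplace {r : ℝ} (hr : 0 < r) :
    HasDerivAt sinhLaplace (-sinhLaplace₁ r) r := by
  have h := (hasDerivAt_integral_of_dominated_loc_of_deriv_le (μ := volume.restrict (Ioi (0 : ℝ)))
    (F := fun r t => Real.exp (-(r * Real.sinh t)))
    (F' := fun r t => -(Real.sinh t * Real.exp (-(r * Real.sinh t))))
    -- The parameter is kept above `r / 2`, so one exponential dominates throughout the
    -- neighbourhood.
    (bound := fun t => Real.sinh t * Real.exp (-(r / 2 * Real.sinh t)))
    (Ioi_mem_nhds (half_lt_self hr)) (Eventually.of_forall fun x => by fun_prop)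
    (integrableOn_exp_neg_sinh hr) (by fun_prop) ?_ (integrableOn_sinh_mul_exp (half_pos hr))
    (Eventually.of_forall fun t x _ => ?_)).2
  · rwa [integral_neg] at h
  · filter_upwards [ae_restrict_mem measurableSet_Ioi] with t ht x hx
    have hs : 0 ≤ Real.sinh t := Real.sinh_nonneg_iff.2 (le_of_lt ht)
    have hx' : r / 2 ≤ x := le_of_lt hx
    rw [norm_neg, Real.norm_eq_abs, abs_of_nonneg (by positivity)]
    gcongr
  · have := (((hasDerivAt_id x).mul_const (Real.sinh t)).neg).exp
    exact this.congr_deriv (by simp only [Pi.neg_apply, id]; ring)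

theorem hasDerivAt_sinhLaplace₁ {r : ℝ} (hr : 0 < r) :
    HasDerivAt sinhLaplace₁ (-sinhLaplace₂ r) r := by
  have h := (hasDerivAt_integral_of_dominated_loc_of_deriv_le (μ := volume.restrict (Ioi (0 : ℝ)))
    (F := fun r t => Real.sinh t * Real.exp (-(r * Real.sinh t)))
    (F' := fun r t => -(Real.sinh t ^ 2 * Real.exp (-(r * Real.sinh t))))
    (bound := fun t => Real.sinh t ^ 2 * Real.exp (-(r / 2 * Real.sinh t)))
    (Ioi_mem_nhds (half_lt_self hr)) (Eventually.of_forall fun x => by fun_prop)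
    (integrableOn_sinh_mul_exp hr) (by fun_prop) ?_ (integrableOn_sinh_sq_mul_exp (half_pos hr))
    (Eventually.of_forall fun t x _ => ?_)).2
  · rwa [integral_neg] at h
  · filter_upwards [ae_restrict_mem measurableSet_Ioi] with t ht x hx
    have hx' : r / 2 ≤ x := le_of_lt hx
    have hs : 0 ≤ Real.sinh t := Real.sinh_nonneg_iff.2 (le_of_lt ht)
    rw [norm_neg, Real.norm_eq_abs, abs_of_nonneg (by positivity)]
    gcongr
  · have := ((((hasDerivAt_id x).mul_const (Real.sinh t)).neg).exp).const_mul (Real.sinh t)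
    exact this.congr_deriv (by simp only [Pi.neg_apply, id]; ring)

theorem tendsto_cosh_mul_exp {c : ℝ} (hc : 0 < c) :
    Tendsto (fun t => Real.cosh t * Real.exp (-(c * Real.sinh t))) atTop (𝓝 0) := by
  have h1 : Tendsto (fun x : ℝ => (1 + x) * Real.exp (-(c * x))) atTop (𝓝 0) := by
    have e1 : Tendsto (fun x : ℝ => Real.exp (-(c * x))) atTop (𝓝 0) :=
      Real.tendsto_exp_neg_atTop_nhds_zero.comp (tendsto_id.const_mul_atTop hc)
    have e2 := ((Real.tendsto_pow_mul_exp_neg_atTop_nhds_zero 1).comp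
      (tendsto_id.const_mul_atTop hc)).const_mul c⁻¹
    have := e1.add e2
    simp only [mul_zero, add_zero] at this
    refine this.congr fun x => ?_
    simp
    field_simp
  refine squeeze_zero' (Eventually.of_forall fun t => by have := Real.cosh_pos t; positivity) ?_
    (h1.comp tendsto_sinh_atTop)
  filter_upwards [eventually_ge_atTop 0] with t ht
  simp only [Function.comp]
  gcongr
  exact cosh_le_one_add_sinh ht

/-- Integrate the derivative of `cosh t · exp(-r sinh t)` and use `cosh² = 1 + sinh²`. With `S =
sinhLaplace` this reads `r S'' + S' + r S = 1`, an inhomogeneous Bessel equation. -/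
theorem sinhLaplace₁_eq {r : ℝ} (hr : 0 < r) :
    sinhLaplace₁ r = -1 + r * (sinhLaplace r + sinhLaplace₂ r) := by
  have hd : ∀ t ∈ Ici (0 : ℝ), HasDerivAt (fun t => Real.cosh t * Real.exp (-(r * Real.sinh t)))
      (Real.sinh t * Real.exp (-(r * Real.sinh t)) - r * (Real.exp (-(r * Real.sinh t))
        + Real.sinh t ^ 2 * Real.exp (-(r * Real.sinh t)))) t := fun t _ => by
    have := (Real.hasDerivAt_cosh t).mul (hasDerivAt_exp_neg_mul_sinh r t)
    refine this.congr_deriv ?_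
    have := Real.cosh_sq t
    linear_combination (-r * Real.exp (-(r * Real.sinh t))) * this
  have i1 := integrableOn_sinh_mul_exp hr
  have i2 := integrableOn_exp_neg_sinh hr
  have i3 := integrableOn_sinh_sq_mul_exp hr
  have i4 : IntegrableOn (fun t => Real.exp (-(r * Real.sinh t)) +
      Real.sinh t ^ 2 * Real.exp (-(r * Real.sinh t))) (Ioi 0) := i2.add i3
  have := integral_Ioi_of_hasDerivAt_of_tendsto' hd (i1.sub (i4.const_mul r))
    (tendsto_cosh_mul_exp hr)
  rw [integral_sub i1 (i4.const_mul r), integral_const_mul, integral_add i2 i3] at this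
  simp at this
  unfold sinhLaplace₁ sinhLaplace sinhLaplace₂
  linarith

/-! ### Small-`r` asymptotics and Euler's constant. -/

theorem integral_log_mul_exp_neg :
    ∫ t in Ioi (0 : ℝ), Real.log t * Real.exp (-t) = -Real.eulerMascheroniConstant := by
  -- Differentiating Euler's integral at `s = 1` identifies the integral with `Γ'(1) = -γ`.
  have h1 := Complex.hasDerivAt_GammaIntegral (s := 1) (by simp)
  have h2 : HasDerivAt Complex.GammaIntegral (-(Real.eulerMascheroniConstant : ℂ)) 1 := by
    refine Complex.hasDerivAt_Gamma_one.congr_of_eventuallyEq ?_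
    have : ∀ᶠ s : ℂ in 𝓝 1, 0 < s.re :=
      (isOpen_lt continuous_const Complex.continuous_re).mem_nhds (by simp)
    filter_upwards [this] with s hs
    exact (Complex.Gamma_eq_integral hs).symm
  have h3 := h1.unique h2
  simp only [sub_self, cpow_zero, one_mul] at h3
  have h4 : ∫ t in Ioi (0 : ℝ), ((Real.log t * Real.exp (-t) : ℝ) : ℂ) =
      -(Real.eulerMascheroniConstant : ℂ) := by
    rw [← h3]; push_cast; rfl
  rw [integral_complex_ofReal] at h4
  exact_mod_cast h4

theorem integrableOn_log_mul_exp_neg :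
    IntegrableOn (fun t => Real.log t * Real.exp (-t)) (Ioi (0 : ℝ)) := by
  -- A non-integrable function would have integral `0` by convention, but the value is `-γ ≠ 0`.
  by_contra h
  have := integral_undef h
  rw [integral_log_mul_exp_neg] at this
  linarith [Real.one_half_lt_eulerMascheroniConstant]

theorem integral_exp_neg_div_Ioi {s : ℝ} (hs : 0 < s) :
    ∫ v in Ioi s, Real.exp (-v) / v =
      (∫ v in Ioi s, Real.log v * Real.exp (-v)) - Real.log s * Real.exp (-s) := by
  have i1 : IntegrableOn (fun v => Real.exp (-v) / v) (Ioi s) := by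
    refine Integrable.mono' ((integrableOn_exp_neg_Ioi s).const_mul s⁻¹)
      (Measurable.aestronglyMeasurable (by fun_prop)) ?_
    filter_upwards [ae_restrict_mem measurableSet_Ioi] with v hv
    have hv' : s < v := hv
    have : 0 < v := hs.trans hv'
    rw [Real.norm_eq_abs, abs_of_nonneg (by positivity), div_eq_inv_mul]
    gcongr
  have i2 : IntegrableOn (fun t => Real.log t * Real.exp (-t)) (Ioi s) :=
    integrableOn_log_mul_exp_neg.mono_set (Ioi_subset_Ioi hs.le)
  have hd : ∀ v ∈ Ici s, HasDerivAt (fun v => Real.log v * Real.exp (-v))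
      (Real.exp (-v) / v - Real.log v * Real.exp (-v)) v := fun v hv => by
    have hv' : 0 < v := hs.trans_le hv
    refine ((Real.hasDerivAt_log hv'.ne').mul (hasDerivAt_neg v).exp).congr_deriv ?_
    field_simp
    ring
  have hlim : Tendsto (fun v => Real.log v * Real.exp (-v)) atTop (𝓝 0) := by
    have e2 := Real.tendsto_pow_mul_exp_neg_atTop_nhds_zero 1
    refine squeeze_zero' ?_ ?_ e2
    · filter_upwards [eventually_ge_atTop 1] with v hv
      have := Real.log_nonneg hv
      positivity
    · filter_upwards [eventually_ge_atTop 1] with v hv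
      rw [pow_one]
      gcongr
      exact Real.log_le_self (by linarith)
  have := integral_Ioi_of_hasDerivAt_of_tendsto' hd (i1.sub i2) hlim
  rw [integral_sub i1 i2] at this
  linarith

theorem integral_exp_neg_mul_exp {s : ℝ} (hs : 0 < s) :
    ∫ t in Ioi (0 : ℝ), Real.exp (-(s * Real.exp t)) = ∫ v in Ioi s, Real.exp (-v) / v := by
  have him : (fun t => s * Real.exp t) '' Ioi 0 = Ioi s := by
    ext v
    constructor
    · rintro ⟨t, ht, rfl⟩
      have : 1 < Real.exp t := Real.one_lt_exp_iff.2 ht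
      simp only [mem_Ioi]
      nlinarith
    · intro hv
      have hv' : s < v := hv
      have : 1 < v / s := by rwa [one_lt_div hs]
      exact ⟨Real.log (v / s), Real.log_pos this, by
        simp only
        rw [Real.exp_log (by linarith)]; field_simp⟩
  rw [← him, integral_image_eq_integral_abs_deriv_smul measurableSet_Ioi
    (fun t _ => ((Real.hasDerivAt_exp t).const_mul s).hasDerivWithinAt)
    (fun x _ y _ h => Real.exp_injective (mul_left_cancel₀ hs.ne' h))]
  refine integral_congr_ae (Eventually.of_forall fun t => ?_)
  simp only [smul_eq_mul]
  rw [abs_of_pos (by positivity)]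
  field_simp

/-- After `v = s e^t` the integral is the exponential integral `E₁(s)`. Integration by parts gives
`log s + E₁(s) = -γ - ∫₀^s log t e^{-t} dt + log s (1 - e^{-s})`, and the last two terms vanish in
the limit. -/
theorem tendsto_log_add_integral_exp_neg_mul_exp :
    Tendsto (fun s => Real.log s + ∫ t in Ioi (0 : ℝ), Real.exp (-(s * Real.exp t))) (𝓝[>] 0)
      (𝓝 (-Real.eulerMascheroniConstant)) := by
  have hprim : Tendsto (fun s => ∫ t in (0 : ℝ)..s, Real.log t * Real.exp (-t)) (𝓝[>] 0) (𝓝 0) := by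
    have hi : IntervalIntegrable (fun t => Real.log t * Real.exp (-t)) volume 0 1 :=
      (intervalIntegrable_iff_integrableOn_Ioc_of_le zero_le_one).2
        (integrableOn_log_mul_exp_neg.mono_set Ioc_subset_Ioi_self)
    have h := intervalIntegral.continuousOn_primitive_interval' hi (left_mem_uIcc)
    have h0 := (h 0 left_mem_uIcc)
    rw [ContinuousWithinAt, intervalIntegral.integral_same] at h0
    refine h0.mono_left ?_
    rw [uIcc_of_le zero_le_one]
    exact nhdsWithin_le_of_mem (mem_of_superset (Ioo_mem_nhdsGT one_pos) Ioo_subset_Icc_self)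
  have hlog : Tendsto (fun s => Real.log s * (1 - Real.exp (-s))) (𝓝[>] 0) (𝓝 0) := by
    have h1 : Tendsto (fun x : ℝ => |Real.log x * x|) (𝓝[>] 0) (𝓝 0) := by
      have := tendsto_log_mul_rpow_nhdsGT_zero (r := 1) one_pos
      simpa using this.abs
    refine squeeze_zero_norm' ?_ h1
    filter_upwards [self_mem_nhdsWithin] with s hs
    have hs' : 0 < s := hs
    rw [Real.norm_eq_abs, abs_mul, abs_mul]
    have h1 := Real.add_one_le_exp (-s)
    have h2 : Real.exp (-s) ≤ 1 := Real.exp_le_one_iff.2 (by linarith)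
    gcongr
    · linarith
  have := (hprim.neg.add hlog).const_add (-Real.eulerMascheroniConstant)
  simp only [neg_zero, add_zero] at this
  refine this.congr' ?_
  filter_upwards [self_mem_nhdsWithin] with s hs
  have hs' : 0 < s := hs
  rw [integral_exp_neg_mul_exp hs', integral_exp_neg_div_Ioi hs']
  have h := intervalIntegral.integral_interval_add_Ioi integrableOn_log_mul_exp_neg
    (integrableOn_log_mul_exp_neg.mono_set (Ioi_subset_Ioi hs'.le))
  rw [integral_log_mul_exp_neg] at h
  linear_combination -h

/-- Replacing `sinh t` by `e^t / 2` drops the factor `exp(x)`, `x = (r/2) e^{-t}`. Since `e^x - 1 ≤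
x e^x` and `x ≤ r/2`, the error integrates to the stated bound. -/
theorem abs_sinhLaplace_sub_le {r : ℝ} (hr : 0 < r) :
    |sinhLaplace r - ∫ t in Ioi (0 : ℝ), Real.exp (-(r / 2 * Real.exp t))| ≤
      r / 2 * Real.exp (r / 2) := by
  have hsplit : ∀ t, Real.exp (-(r * Real.sinh t)) =
      Real.exp (-(r / 2 * Real.exp t)) * Real.exp (r / 2 * Real.exp (-t)) := fun t => by
    rw [← Real.exp_add, Real.sinh_eq]; congr 1; ring
  have i1 := integrableOn_exp_neg_sinh hr
  have i2 : IntegrableOn (fun t => Real.exp (-(r / 2 * Real.exp t))) (Ioi 0) := by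
    refine Integrable.mono' i1 (by fun_prop) (Eventually.of_forall fun t => ?_)
    rw [Real.norm_eq_abs, Real.abs_exp, hsplit]
    exact le_mul_of_one_le_right (Real.exp_pos _).le (Real.one_le_exp (by positivity))
  rw [sinhLaplace, ← integral_sub i1 i2, ← Real.norm_eq_abs]
  refine (norm_integral_le_of_norm_le
    ((integrableOn_exp_neg_Ioi 0).const_mul (r / 2 * Real.exp (r / 2))) ?_).trans_eq ?_
  · filter_upwards [ae_restrict_mem measurableSet_Ioi] with t ht
    have ht' : 0 < t := ht
    set x := r / 2 * Real.exp (-t) with hx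
    have hx0 : 0 ≤ x := by positivity
    have hxr : x ≤ r / 2 := by
      have : Real.exp (-t) ≤ 1 := Real.exp_le_one_iff.2 (by linarith)
      rw [hx]; nlinarith
    have hE : Real.exp (-(r / 2 * Real.exp t)) ≤ 1 := Real.exp_le_one_iff.2 (by
      rw [neg_nonpos]; positivity)
    have h1 : Real.exp x - 1 ≤ x * Real.exp x := by
      have h := Real.add_one_le_exp (-x)
      have h' : Real.exp (-x) * Real.exp x = 1 := by rw [← Real.exp_add]; simp
      nlinarith [Real.exp_pos x]
    have h2 : 0 ≤ Real.exp x - 1 := by linarith [Real.one_le_exp hx0]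
    have h3 : Real.exp x ≤ Real.exp (r / 2) := Real.exp_le_exp.2 hxr
    rw [hsplit, Real.norm_eq_abs, abs_of_nonneg (by nlinarith [Real.exp_pos (-(r / 2 * Real.exp t))])]
    calc _ = Real.exp (-(r / 2 * Real.exp t)) * (Real.exp x - 1) := by ring
      _ ≤ 1 * (x * Real.exp x) := by gcongr
      _ ≤ 1 * (x * Real.exp (r / 2)) := by gcongr
      _ = _ := by rw [hx]; ring
  · rw [integral_const_mul, integral_exp_neg_Ioi_zero, mul_one]

theorem tendsto_sinhLaplace :
    Tendsto (fun r => sinhLaplace r + (Real.log (r / 2) + Real.eulerMascheroniConstant))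
      (𝓝[>] 0) (𝓝 0) := by
  have h1 : Tendsto (fun r => sinhLaplace r - ∫ t in Ioi (0 : ℝ), Real.exp (-(r / 2 * Real.exp t)))
      (𝓝[>] 0) (𝓝 0) := by
    have hc : Continuous fun r : ℝ => r / 2 * Real.exp (r / 2) := by fun_prop
    have h0 : Tendsto (fun r : ℝ => r / 2 * Real.exp (r / 2)) (𝓝[>] 0) (𝓝 0) := by
      simpa using (hc.tendsto 0).mono_left nhdsWithin_le_nhds
    refine squeeze_zero_norm' ?_ h0
    filter_upwards [self_mem_nhdsWithin] with r hr
    exact abs_sinhLaplace_sub_le hr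
  have h2 : Tendsto (fun r : ℝ => r / 2) (𝓝[>] 0) (𝓝[>] 0) := by
    refine tendsto_nhdsWithin_iff.2 ⟨?_, ?_⟩
    · have hc : Continuous fun r : ℝ => r / 2 := by fun_prop
      simpa using (hc.tendsto 0).mono_left nhdsWithin_le_nhds
    · filter_upwards [self_mem_nhdsWithin] with r hr
      exact half_pos (mem_Ioi.1 hr)
  have h3 := h1.add ((tendsto_log_add_integral_exp_neg_mul_exp.comp h2).add_const
    Real.eulerMascheroniConstant)
  rw [neg_add_cancel, add_zero] at h3
  refine h3.congr fun r => ?_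
  simp only [Function.comp]
  ring

/-- Writing `1/r` as `∫ cosh t · exp(-r sinh t) dt` and using `cosh t - sinh t = e^{-t}`, the
difference is `-∫ e^{-t} exp(-r sinh t) dt`, which tends to `-1`. -/
theorem tendsto_sinhLaplace₁ :
    Tendsto (fun r => sinhLaplace₁ r - 1 / r) (𝓝[>] 0) (𝓝 (-1)) := by
  have h : Tendsto (fun r => ∫ t in Ioi (0 : ℝ), Real.exp (-t) * Real.exp (-(r * Real.sinh t)))
      (𝓝[>] 0) (𝓝 (∫ t in Ioi (0 : ℝ), Real.exp (-t))) := by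
    refine tendsto_integral_filter_of_dominated_convergence (fun t => Real.exp (-t))
      (Eventually.of_forall fun r => by fun_prop) ?_ (integrableOn_exp_neg_Ioi 0)
      (Eventually.of_forall fun t => ?_)
    · filter_upwards [self_mem_nhdsWithin] with r hr
      have hr' : 0 < r := hr
      filter_upwards [ae_restrict_mem measurableSet_Ioi] with t ht
      have hs : 0 ≤ Real.sinh t := Real.sinh_nonneg_iff.2 (le_of_lt ht)
      rw [Real.norm_eq_abs, abs_of_nonneg (by positivity)]
      refine mul_le_of_le_one_right (Real.exp_pos _).le (Real.exp_le_one_iff.2 ?_)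
      rw [neg_nonpos]; positivity
    · have hc : Continuous fun r => Real.exp (-t) * Real.exp (-(r * Real.sinh t)) := by fun_prop
      simpa using (hc.tendsto 0).mono_left nhdsWithin_le_nhds
  rw [integral_exp_neg_Ioi_zero] at h
  refine h.neg.congr' ?_
  filter_upwards [self_mem_nhdsWithin] with r hr
  have hr' : 0 < r := hr
  rw [← integral_cosh_mul_exp hr', sinhLaplace₁, ← integral_neg,
    ← integral_sub (integrableOn_sinh_mul_exp hr') (integrableOn_cosh_mul_exp hr')]
  refine integral_congr_ae (Eventually.of_forall fun t => ?_)
  simp only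
  rw [← Real.cosh_sub_sinh t]
  ring

/-! ### The integral representation of the Hankel function. -/

/-- `∫ g(θ) e^{i r cos θ} dθ` over `(-π/2, π/2)`. -/
def angularIntegral (g : ℝ → ℂ) (r : ℝ) : ℂ :=
  ∫ θ in (-(Real.pi / 2))..(Real.pi / 2), g θ * cexp (I * (r * Real.cos θ : ℝ))

theorem norm_exp_I_mul_ofReal (x : ℝ) : ‖cexp (I * (x : ℂ))‖ = 1 := by
  rw [mul_comm]; exact Complex.norm_exp_ofReal_mul_I x

theorem hasDerivAt_angularIntegral {g : ℝ → ℂ} (hg : Continuous g) (r : ℝ) :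
    HasDerivAt (angularIntegral g) (angularIntegral (fun θ => g θ * (I * Real.cos θ)) r) r := by
  refine (intervalIntegral.hasDerivAt_integral_of_dominated_loc_of_deriv_le
    (F := fun (r θ : ℝ) => g θ * cexp (I * (r * Real.cos θ : ℝ)))
    (F' := fun (r θ : ℝ) => g θ * (I * Real.cos θ) * cexp (I * (r * Real.cos θ : ℝ)))
    (bound := fun θ => ‖g θ‖) univ_mem (Eventually.of_forall fun x => ?_) ?_ ?_
    (Eventually.of_forall fun θ _ x _ => ?_) ?_ (Eventually.of_forall fun θ _ x _ => ?_)).2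
  · exact Continuous.aestronglyMeasurable (by fun_prop)
  · exact Continuous.intervalIntegrable (by fun_prop) _ _
  · exact Continuous.aestronglyMeasurable (by fun_prop)
  · rw [norm_mul, norm_mul, norm_mul, norm_exp_I_mul_ofReal, norm_I, norm_real, Real.norm_eq_abs]
    have := Real.abs_cos_le_one θ
    have := norm_nonneg (g θ)
    nlinarith
  · exact Continuous.intervalIntegrable (by fun_prop) _ _
  · have h := ((((hasDerivAt_id x).mul_const (Real.cos θ)).ofReal_comp.const_mul I).cexp).const_mul
      (g θ)
    exact h.congr_deriv (by simp only [id]; push_cast; ring)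

theorem continuous_angularIntegral {g : ℝ → ℂ} (hg : Continuous g) :
    Continuous (angularIntegral g) :=
  continuous_iff_continuousAt.2 fun r => (hasDerivAt_angularIntegral hg r).continuousAt

/-- With `e = angularIntegral 1` this is `r e'' + e' + r e = 2i`, by integrating the derivative of
`i sin θ · exp(i r cos θ)`. The right-hand side is `2i` times that for `sinhLaplace`, so `e - 2i S`
solves the homogeneous equation. The factors `1 *` match the form in which
`hasDerivAt_angularIntegral` produces derivatives. -/
theorem angularIntegral_parts (r : ℝ) :
    angularIntegral (fun θ => 1 * (I * Real.cos θ)) r =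
      2 * I - r * (angularIntegral (fun _ => 1) r +
        angularIntegral (fun θ => 1 * (I * Real.cos θ) * (I * Real.cos θ)) r) := by
  have hd : ∀ θ : ℝ, HasDerivAt (fun θ : ℝ => I * Real.sin θ * cexp (I * (r * Real.cos θ : ℝ)))
      (1 * (I * Real.cos θ) * cexp (I * (r * Real.cos θ : ℝ)) +
        r * (1 * cexp (I * (r * Real.cos θ : ℝ)) +
        1 * (I * Real.cos θ) * (I * Real.cos θ) * cexp (I * (r * Real.cos θ : ℝ)))) θ := fun θ => by
    have h := ((Real.hasDerivAt_sin θ).ofReal_comp.const_mul I).mul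
      (((((Real.hasDerivAt_cos θ).const_mul r).ofReal_comp).const_mul I).cexp)
    refine h.congr_deriv ?_
    have h1 : (Real.sin θ : ℂ) ^ 2 + (Real.cos θ : ℂ) ^ 2 = 1 := by
      exact_mod_cast Real.sin_sq_add_cos_sq θ
    push_cast at h1 ⊢
    linear_combination (r * cexp (I * (r * Complex.cos θ))) * h1 -
      (r * Complex.sin θ ^ 2 + r * Complex.cos θ ^ 2) * cexp (I * (r * Complex.cos θ)) * I_sq
  have i1 : IntervalIntegrable (fun θ : ℝ => 1 * (I * Real.cos θ) *
      cexp (I * (r * Real.cos θ : ℝ))) volume (-(Real.pi / 2)) (Real.pi / 2) :=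
    Continuous.intervalIntegrable (by fun_prop) _ _
  have i2 : IntervalIntegrable (fun θ : ℝ => 1 * cexp (I * (r * Real.cos θ : ℝ)))
      volume (-(Real.pi / 2)) (Real.pi / 2) :=
    Continuous.intervalIntegrable (by fun_prop) _ _
  have i3 : IntervalIntegrable (fun θ : ℝ => 1 * (I * Real.cos θ) * (I * Real.cos θ) *
      cexp (I * (r * Real.cos θ : ℝ))) volume (-(Real.pi / 2)) (Real.pi / 2) :=
    Continuous.intervalIntegrable (by fun_prop) _ _
  have h := intervalIntegral.integral_eq_sub_of_hasDerivAt (fun θ _ => hd θ)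
    (i1.add ((i2.add i3).const_mul r))
  rw [intervalIntegral.integral_add i1 ((i2.add i3).const_mul r),
    intervalIntegral.integral_const_mul, intervalIntegral.integral_add i2 i3] at h
  simp only [Real.sin_neg, Real.cos_neg, Real.sin_pi_div_two, Real.cos_pi_div_two] at h
  simp only [mul_zero, ofReal_zero, Complex.exp_zero, ofReal_neg, ofReal_one] at h
  unfold angularIntegral
  linear_combination h

/-- An integral representation of the Hankel function. -/
theorem hankelH0_eq {r : ℝ} (hr : 0 < r) :
    hankelH0 r = (Real.pi : ℂ)⁻¹ * (angularIntegral (fun _ => 1) r - 2 * I * sinhLaplace r) := by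
  have hpi : (Real.pi : ℂ) ≠ 0 := by exact_mod_cast Real.pi_ne_zero
  have hc1 : Continuous fun _ : ℝ => (1 : ℂ) := continuous_const
  have hc2 : Continuous fun θ : ℝ => (1 : ℂ) * (I * Real.cos θ) := by fun_prop
  set e := angularIntegral (fun _ => 1)
  set e₁ := angularIntegral (fun θ => 1 * (I * Real.cos θ)) with he₁
  set w : ℝ → ℂ := fun r => (Real.pi : ℂ)⁻¹ * (e r - 2 * I * sinhLaplace r) with hw
  set p : ℝ → ℂ := fun r => (Real.pi : ℂ)⁻¹ * (r * (e₁ r + 2 * I * sinhLaplace₁ r)) with hp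
  have hdw : ∀ r > 0, HasDerivAt w (p r / r) r := fun r hr => by
    have hr' : (r : ℂ) ≠ 0 := by exact_mod_cast hr.ne'
    refine (((hasDerivAt_angularIntegral hc1 r).sub
      ((hasDerivAt_sinhLaplace hr).ofReal_comp.const_mul (2 * I))).const_mul _).congr_deriv ?_
    simp only [hp, he₁]
    push_cast
    field_simp
    ring
  have hdp : ∀ r > 0, HasDerivAt p (-(r * w r)) r := fun r hr => by
    refine (((hasDerivAt_id r).ofReal_comp.mul ((hasDerivAt_angularIntegral hc2 r).add
      ((hasDerivAt_sinhLaplace₁ hr).ofReal_comp.const_mul (2 * I)))).const_mul _).congr_deriv ?_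
    have h1 := angularIntegral_parts r
    have h2 : (sinhLaplace₁ r : ℂ) = -1 + r * (sinhLaplace r + sinhLaplace₂ r) := by
      exact_mod_cast sinhLaplace₁_eq hr
    simp only [hw, id, ofReal_one, one_mul, Pi.add_apply]
    push_cast at h1 ⊢
    simp only [one_mul] at h1 ⊢
    linear_combination (Real.pi : ℂ)⁻¹ * (h1 + 2 * I * h2)
  -- As `r → 0`, `e → π` and `S ≈ -(log(r/2) + γ)`, which gives exactly the singular part of `H₀`.
  have hw0 : Tendsto (fun r => w r - hankelSing r) (𝓝[>] 0) (𝓝 0) := by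
    have h1 : Tendsto e (𝓝[>] 0) (𝓝 (Real.pi : ℂ)) := by
      have h := ((continuous_angularIntegral hc1).tendsto 0).mono_left
        (nhdsWithin_le_nhds (s := Ioi 0))
      convert! h using 2
      simp [angularIntegral]
    have h2 := ((h1.sub_const (Real.pi : ℂ)).sub
      ((tendsto_sinhLaplace.ofReal).const_mul (2 * I))).const_mul (Real.pi : ℂ)⁻¹
    simp only [sub_self, ofReal_zero, mul_zero] at h2
    refine h2.congr fun r => ?_
    simp only [hw, hankelSing]
    push_cast
    field_simp
    ring
  have hp0 : Tendsto (fun r : ℝ => p r / r - I * ((2 / (Real.pi * r) : ℝ) : ℂ)) (𝓝[>] 0) (𝓝 0) := by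
    have h1 : Tendsto e₁ (𝓝[>] 0) (𝓝 (2 * I)) := by
      have h := ((continuous_angularIntegral hc2).tendsto 0).mono_left
        (nhdsWithin_le_nhds (s := Ioi 0))
      convert! h using 2
      rw [angularIntegral_parts]
      simp
    have h2 := (h1.add ((tendsto_sinhLaplace₁.ofReal).const_mul (2 * I))).const_mul (Real.pi : ℂ)⁻¹
    simp only [ofReal_neg, ofReal_one, mul_neg, mul_one, add_neg_cancel, mul_zero] at h2
    refine h2.congr' ?_
    filter_upwards [self_mem_nhdsWithin] with r hr
    have hr' : (r : ℂ) ≠ 0 := by exact_mod_cast (ne_of_gt hr)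
    simp only [hp]
    push_cast
    field_simp
    ring
  have key := bessel_unique (U := fun r => hankelH0 r - w r) (P := fun r => hankelFlux r - p r)
    (fun x hx => ((hasDerivAt_hankelH0 hx).sub (hdw x hx)).congr_deriv (by ring))
    (fun x hx => ((hasDerivAt_hankelFlux hx).sub (hdp x hx)).congr_deriv (by ring))
    (by simpa using tendsto_hankelH0_sub_sing.sub hw0)
    (by
      have := tendsto_hankelFlux_div_sub.sub hp0
      rw [sub_zero] at this
      exact this.congr fun x => by ring) hr
  exact sub_eq_zero.1 key

/-! ### Rotation invariance and Weyl's plane wave representation. -/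

/-- The contribution `∫₀^∞ e^{-y sinh t + i x cosh t} dt` of evanescent waves. -/
def evanescent (x y : ℝ) : ℂ :=
  ∫ t in Ioi (0 : ℝ), cexp ((-(y * Real.sinh t) : ℝ) + I * (x * Real.cosh t : ℝ))

theorem norm_exp_evanescent (a b : ℝ) : ‖cexp ((a : ℂ) + I * (b : ℂ))‖ = Real.exp a := by
  rw [Complex.exp_add, norm_mul, norm_exp_I_mul_ofReal, mul_one, Complex.norm_exp_ofReal]

theorem integrableOn_evanescent (x : ℝ) {y : ℝ} (hy : 0 < y) :
    IntegrableOn (fun t : ℝ => cexp ((-(y * Real.sinh t) : ℝ) + I * (x * Real.cosh t : ℝ)))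
      (Ioi 0) :=
  Integrable.mono' (integrableOn_exp_neg_sinh hy)
    (Continuous.aestronglyMeasurable (by fun_prop))
    (Eventually.of_forall fun t => by rw [norm_exp_evanescent])

/-- The exponent is `-r sinh(t - iα)`, so the `α`-derivative of the integrand is `-i` times its
`t`-derivative. The integral therefore changes only through the endpoint `t = 0`. -/
theorem hasDerivAt_evanescent_rotate {r α : ℝ} (hr : 0 < r) (hα : 0 < Real.cos α) :
    HasDerivAt (fun α => evanescent (r * Real.sin α) (r * Real.cos α))
      (I * cexp (I * (r * Real.sin α : ℝ))) α := by
  set F : ℝ → ℝ → ℂ := fun α t =>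
    cexp ((-(r * Real.cos α * Real.sinh t) : ℝ) + I * (r * Real.sin α * Real.cosh t : ℝ)) with hF
  set F' : ℝ → ℝ → ℂ := fun α t =>
    ((r * Real.sin α * Real.sinh t : ℝ) + I * (r * Real.cos α * Real.cosh t : ℝ)) * F α t with hF'
  have hd := hasDerivAt_integral_of_dominated_loc_of_deriv_le
    (μ := volume.restrict (Ioi (0 : ℝ))) (F := F) (F' := F') (x₀ := α)
    (s := {β | Real.cos α / 2 < Real.cos β})
    (bound := fun t => 2 * r * (Real.cosh t * Real.exp (-(r * (Real.cos α / 2) * Real.sinh t))))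
    ((isOpen_lt continuous_const Real.continuous_cos).mem_nhds (half_lt_self hα))
    (Eventually.of_forall fun β => Continuous.aestronglyMeasurable (by fun_prop))
    (integrableOn_evanescent _ (by positivity))
    (Continuous.aestronglyMeasurable (by fun_prop)) ?_
    ((integrableOn_cosh_mul_exp (by positivity)).const_mul _)
    (Eventually.of_forall fun t β _ => ?_)
  · refine hd.2.congr_deriv ?_
    have hdt : ∀ t ∈ Ici (0 : ℝ), HasDerivAt (fun t => -I * F α t) (F' α t) t := fun t _ => by
      have h := (((((Real.hasDerivAt_sinh t).const_mul (r * Real.cos α)).neg).ofReal_comp.add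
        (((Real.hasDerivAt_cosh t).const_mul (r * Real.sin α)).ofReal_comp.const_mul I)).cexp
        ).const_mul (-I)
      refine h.congr_deriv ?_
      simp only [hF', hF, Pi.add_apply, Pi.neg_apply]
      push_cast
      linear_combination (-r * Complex.sin α * Complex.sinh t) * cexp (-(r * Complex.cos α *
        Complex.sinh t) + I * (r * Complex.sin α * Complex.cosh t)) * I_sq
    have hlim : Tendsto (fun t => -I * F α t) atTop (𝓝 0) := by
      rw [tendsto_zero_iff_norm_tendsto_zero]
      refine (tendsto_exp_neg_mul_sinh (c := r * Real.cos α) (by positivity)).congr fun t => ?_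
      rw [norm_mul, norm_neg, norm_I, one_mul, norm_exp_evanescent]
    rw [integral_Ioi_of_hasDerivAt_of_tendsto' hdt hd.1 hlim]
    simp [hF]
  · filter_upwards [ae_restrict_mem measurableSet_Ioi] with t ht β hβ
    have hs : 0 ≤ Real.sinh t := Real.sinh_nonneg_iff.2 (le_of_lt ht)
    have hc : 0 < Real.cosh t := Real.cosh_pos t
    have hβ' : Real.cos α / 2 ≤ Real.cos β := le_of_lt hβ
    simp only [hF', hF]
    rw [norm_mul, norm_exp_evanescent, ← mul_assoc]
    have h1 : ‖((r * Real.sin β * Real.sinh t : ℝ) : ℂ) + I * (r * Real.cos β * Real.cosh t : ℝ)‖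
        ≤ 2 * r * Real.cosh t := by
      refine (norm_add_le _ _).trans ?_
      rw [norm_mul, norm_I, one_mul, norm_real, norm_real, Real.norm_eq_abs, Real.norm_eq_abs,
        abs_mul, abs_mul, abs_mul, abs_mul, abs_of_pos hr, abs_of_pos hc, abs_of_nonneg hs]
      have a1 : r * |Real.sin β| * Real.sinh t ≤ r * 1 * Real.cosh t := by
        gcongr
        · exact Real.abs_sin_le_one β
        · exact (Real.sinh_lt_cosh t).le
      have a2 : r * |Real.cos β| * Real.cosh t ≤ r * 1 * Real.cosh t := by
        gcongr
        exact Real.abs_cos_le_one β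
      linarith
    gcongr
  · have h := ((((((Real.hasDerivAt_cos β).const_mul r).mul_const (Real.sinh t)).neg).ofReal_comp).add
      (((((Real.hasDerivAt_sin β).const_mul r).mul_const (Real.cosh t)).ofReal_comp).const_mul I)).cexp
    refine h.congr_deriv ?_
    simp only [hF', hF, Pi.add_apply, Pi.neg_apply]
    push_cast
    ring

/-- The contribution `∫ e^{i (y cos θ + x sin θ)} dθ` of propagating waves. -/
def propagating (x y : ℝ) : ℂ :=
  ∫ θ in (-(Real.pi / 2))..(Real.pi / 2), cexp (I * (y * Real.cos θ + x * Real.sin θ : ℝ))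

/-- Since `y cos θ + x sin θ = r cos(θ - α)`, a rotation only moves the limits of integration. -/
theorem propagating_polar (r α : ℝ) :
    propagating (r * Real.sin α) (r * Real.cos α) =
      ∫ θ in (-(Real.pi / 2) - α)..(Real.pi / 2 - α), cexp (I * (r * Real.cos θ : ℝ)) := by
  rw [← intervalIntegral.integral_comp_sub_right
    (fun θ => cexp (I * (r * Real.cos θ : ℝ)))]
  unfold propagating
  refine intervalIntegral.integral_congr fun θ _ => ?_
  rw [Real.cos_sub]
  congr 3
  ring

theorem hasDerivAt_propagating_rotate (r α : ℝ) :
    HasDerivAt (fun α => propagating (r * Real.sin α) (r * Real.cos α))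
      (cexp (-(I * (r * Real.sin α : ℝ))) - cexp (I * (r * Real.sin α : ℝ))) α := by
  have hcont : Continuous fun θ : ℝ => cexp (I * (r * Real.cos θ : ℝ)) := by fun_prop
  simp_rw [propagating_polar]
  have hsplit : ∀ β : ℝ, (∫ θ in (-(Real.pi / 2) - β)..(Real.pi / 2 - β),
      cexp (I * (r * Real.cos θ : ℝ))) = (∫ θ in (0 : ℝ)..(Real.pi / 2 - β),
      cexp (I * (r * Real.cos θ : ℝ))) - ∫ θ in (0 : ℝ)..(-(Real.pi / 2) - β),
      cexp (I * (r * Real.cos θ : ℝ)) := fun β => by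
    rw [intervalIntegral.integral_interval_sub_left] <;> exact hcont.intervalIntegrable _ _
  simp_rw [hsplit]
  have hp : ∀ b : ℝ, HasDerivAt (fun u => ∫ θ in (0 : ℝ)..u, cexp (I * (r * Real.cos θ : ℝ)))
      (cexp (I * (r * Real.cos b : ℝ))) b := fun b =>
    intervalIntegral.integral_hasDerivAt_right (hcont.intervalIntegrable _ _)
      (hcont.stronglyMeasurableAtFilter _ _) hcont.continuousAt
  have h1 := (hp (Real.pi / 2 - α)).scomp α ((hasDerivAt_id α).const_sub (Real.pi / 2))
  have h2 := (hp (-(Real.pi / 2) - α)).scomp α ((hasDerivAt_id α).const_sub (-(Real.pi / 2)))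
  refine (h1.sub h2).congr_deriv ?_
  rw [Real.cos_pi_div_two_sub, ← Real.cos_neg (-(Real.pi / 2) - α),
    show -(-(Real.pi / 2) - α) = α + Real.pi / 2 by ring, Real.cos_add_pi_div_two]
  simp
  ring

/-- The three integrals are pieces of one contour in the complex angle; rotation shifts it, and the
endpoint terms at the two junctions cancel. -/
theorem propagating_sub_evanescent_rotate {r α : ℝ} (hr : 0 < r)
    (hα : α ∈ Ioo (-(Real.pi / 2)) (Real.pi / 2)) :
    propagating (r * Real.sin α) (r * Real.cos α) - I *
      (evanescent (r * Real.sin α) (r * Real.cos α) +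
        evanescent (-(r * Real.sin α)) (r * Real.cos α)) =
    propagating 0 r - I * (evanescent 0 r + evanescent 0 r) := by
  set W : ℝ → ℂ := fun α => propagating (r * Real.sin α) (r * Real.cos α) - I *
      (evanescent (r * Real.sin α) (r * Real.cos α) +
        evanescent (-(r * Real.sin α)) (r * Real.cos α)) with hW
  have hd : ∀ β ∈ Ioo (-(Real.pi / 2)) (Real.pi / 2), HasDerivAt W 0 β := fun β hβ => by
    have h1 := hasDerivAt_evanescent_rotate hr (Real.cos_pos_of_mem_Ioo hβ)
    have h2 := (hasDerivAt_evanescent_rotate hr (α := -β)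
      (by rw [Real.cos_neg]; exact Real.cos_pos_of_mem_Ioo hβ)).scomp β (hasDerivAt_neg β)
    have h3 : HasDerivAt (fun α => evanescent (-(r * Real.sin α)) (r * Real.cos α))
        (-(I * cexp (-(I * (r * Real.sin β : ℝ))))) β := by
      refine (h2.congr_of_eventuallyEq (Eventually.of_forall fun γ => ?_)).congr_deriv ?_
      · simp
      · simp
    refine ((hasDerivAt_propagating_rotate r β).sub ((h1.add h3).const_mul I)).congr_deriv ?_
    linear_combination (cexp (-(I * (r * Real.sin β : ℝ))) - cexp (I * (r * Real.sin β : ℝ))) * I_sq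
  have h0 : (0 : ℝ) ∈ Ioo (-(Real.pi / 2)) (Real.pi / 2) := by
    constructor <;> linarith [Real.pi_pos]
  have := isOpen_Ioo.is_const_of_deriv_eq_zero isPreconnected_Ioo
    (fun β hβ => (hd β hβ).differentiableAt.differentiableWithinAt)
    (fun β hβ => (hd β hβ).deriv) hα h0
  simpa [hW] using this

/-- Weyl's representation of the Hankel function as a superposition of plane waves. -/
theorem hankelH0_eq_planeWaves (x : ℝ) {y : ℝ} (hy : 0 < y) :
    hankelH0 (Real.sqrt (x ^ 2 + y ^ 2)) =
      (Real.pi : ℂ)⁻¹ * (propagating x y - I * (evanescent x y + evanescent (-x) y)) := by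
  -- The angle is measured from the vertical axis, so `y > 0` means `arg z ∈ (-π/2, π/2)`.
  set z : ℂ := ⟨y, x⟩ with hz
  have hr : Real.sqrt (x ^ 2 + y ^ 2) = ‖z‖ := by
    rw [Complex.norm_def, Complex.normSq_mk]
    congr 1; ring
  have hre : 0 < z.re := hy
  have hz0 : z ≠ 0 := fun h => by rw [h] at hre; simp at hre
  have hr0 : 0 < ‖z‖ := norm_pos_iff.2 hz0
  have hα : z.arg ∈ Ioo (-(Real.pi / 2)) (Real.pi / 2) := by
    have := (Complex.abs_arg_lt_pi_div_two_iff (z := z)).2 (Or.inl hre)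
    exact abs_lt.1 this
  have hx : x = ‖z‖ * Real.sin z.arg := (Complex.norm_mul_sin_arg z).symm
  have hy' : y = ‖z‖ * Real.cos z.arg := (Complex.norm_mul_cos_arg z).symm
  have h := propagating_sub_evanescent_rotate hr0 hα
  rw [← hx, ← hy'] at h
  rw [hr, h, hankelH0_eq hr0]
  have h1 : propagating 0 ‖z‖ = angularIntegral (fun _ => 1) ‖z‖ := by
    simp [propagating, angularIntegral]
  have h2 : evanescent 0 ‖z‖ = sinhLaplace ‖z‖ := by
    rw [sinhLaplace, ← integral_complex_ofReal]
    simp [evanescent]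
  rw [h1, h2]
  ring

theorem norm_plane_eq (r : Plane) : ‖r‖ = Real.sqrt (r 0 ^ 2 + r 1 ^ 2) := by
  rw [EuclideanSpace.norm_eq, Fin.sum_univ_two]
  simp

/-- Weyl's representation of the outgoing fundamental solution in the upper half plane. -/
theorem outgoingG_eq {k₀ : ℝ} (hk₀ : 0 < k₀) {r : Plane} (hr : 0 < r 1) :
    outgoingG k₀ r = I / (4 * Real.pi) * (propagating (k₀ * r 0) (k₀ * r 1) -
      I * (evanescent (k₀ * r 0) (k₀ * r 1) + evanescent (-(k₀ * r 0)) (k₀ * r 1))) := by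
  have h : k₀ * ‖r‖ = Real.sqrt ((k₀ * r 0) ^ 2 + (k₀ * r 1) ^ 2) := by
    rw [norm_plane_eq, mul_pow, mul_pow, ← mul_add, Real.sqrt_mul (sq_nonneg _),
      Real.sqrt_sq hk₀.le]
  rw [outgoingG, h, hankelH0_eq_planeWaves _ (mul_pos hk₀ hr)]
  ring

theorem measurable_outgoingG (k₀ : ℝ) : Measurable (outgoingG k₀) :=
  (measurable_hankelH0.comp (by fun_prop)).const_mul (I / 4)

theorem norm_evanescent_le (x : ℝ) {y δ : ℝ} (hδ : 0 < δ) (hy : δ ≤ y) :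
    ‖evanescent x y‖ ≤ sinhLaplace δ := by
  refine norm_integral_le_of_norm_le (integrableOn_exp_neg_sinh hδ) ?_
  filter_upwards [ae_restrict_mem measurableSet_Ioi] with t ht
  have hs : 0 ≤ Real.sinh t := Real.sinh_nonneg_iff.2 (le_of_lt ht)
  rw [norm_exp_evanescent]
  gcongr

theorem norm_propagating_le (x y : ℝ) : ‖propagating x y‖ ≤ Real.pi := by
  have h := intervalIntegral.norm_integral_le_of_norm_le_const (a := -(Real.pi / 2))
    (b := Real.pi / 2) (C := 1)
    (f := fun θ : ℝ => cexp (I * (y * Real.cos θ + x * Real.sin θ : ℝ)))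
    (fun θ _ => by rw [norm_exp_I_mul_ofReal])
  refine h.trans_eq ?_
  rw [one_mul, sub_neg_eq_add, add_halves, abs_of_pos Real.pi_pos]

/-- Weyl's formula bounds `G` on the whole half plane at once, with no asymptotics of `H₀` at
infinity. -/
theorem norm_outgoingG_le {k₀ δ : ℝ} (hk₀ : 0 < k₀) (hδ : 0 < δ) {r : Plane} (hr : δ ≤ r 1) :
    ‖outgoingG k₀ r‖ ≤
      (4 * Real.pi)⁻¹ * (Real.pi + (sinhLaplace (k₀ * δ) + sinhLaplace (k₀ * δ))) := by
  have hb : k₀ * δ ≤ k₀ * r 1 := by gcongr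
  rw [outgoingG_eq hk₀ (hδ.trans_le hr), norm_mul]
  have h1 : ‖I / (4 * (Real.pi : ℂ))‖ = (4 * Real.pi)⁻¹ := by
    rw [norm_div, norm_I, norm_mul, norm_real, Real.norm_eq_abs, abs_of_pos Real.pi_pos]
    simp
  rw [h1]
  have hpi := Real.pi_pos
  gcongr
  refine (norm_sub_le _ _).trans (add_le_add (norm_propagating_le _ _) ?_)
  rw [norm_mul, norm_I, one_mul]
  exact (norm_add_le _ _).trans (add_le_add (norm_evanescent_le _ (by positivity) hb)
    (norm_evanescent_le _ (by positivity) hb))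

/-! ### Fourier transform of the fundamental solution along the line. -/

theorem integral_schwartzFourier_mul_exp (φ : 𝓢(ℝ, ℂ)) (ξ : ℝ) :
    ∫ x : ℝ, schwartzFourier φ x * cexp (I * (ξ * x : ℝ)) = (Real.sqrt (2 * Real.pi) : ℂ) * φ ξ := by
  have hpi := Real.pi_pos
  have hinv : ∫ v : ℝ, cexp (2 * Real.pi * I * (v * ξ : ℝ)) • (𝓕 φ : 𝓢(ℝ, ℂ)) v = φ ξ := by
    have h : (𝓕⁻ (𝓕 φ) : 𝓢(ℝ, ℂ)) ξ = φ ξ := by rw [FourierTransform.fourierInv_fourier_eq]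
    rw [SchwartzMap.fourierInv_coe, Real.fourierInv_eq'] at h
    rw [← h]
    refine integral_congr_ae (Eventually.of_forall fun v => ?_)
    simp only [RCLike.inner_apply, conj_trivial]
    congr 2
    push_cast; ring
  obtain ⟨g, hg⟩ : ∃ g : ℝ → ℂ, g = fun v : ℝ => (((2 * Real.pi) ^ (-(1 : ℝ) / 2) : ℝ) : ℂ) *
      (cexp (2 * Real.pi * I * (v * ξ : ℝ)) • (𝓕 φ : 𝓢(ℝ, ℂ)) v) := ⟨_, rfl⟩
  have hgi : ∫ v, g v = (((2 * Real.pi) ^ (-(1 : ℝ) / 2) : ℝ) : ℂ) * φ ξ := by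
    rw [hg, integral_const_mul, hinv]
  have hval : ∀ x : ℝ, schwartzFourier φ x * cexp (I * (ξ * x : ℝ)) =
      g ((2 * Real.pi)⁻¹ * x) := by
    intro x
    have h1 : schwartzFourier φ x = (((2 * Real.pi) ^ (-(1 : ℝ) / 2) : ℝ) : ℂ) *
        (𝓕 φ : 𝓢(ℝ, ℂ)) ((2 * Real.pi)⁻¹ * x) := by
      simp [schwartzFourier, dilation, mul_comm]
    rw [h1]
    have h2 : (2 * Real.pi * I * ((((2 * Real.pi)⁻¹ * x) * ξ : ℝ) : ℂ)) = I * (ξ * x : ℝ) := by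
      have : (Real.pi : ℂ) ≠ 0 := by exact_mod_cast hpi.ne'
      push_cast
      field_simp
    simp only [hg, h2, smul_eq_mul]
    ring
  simp_rw [hval]
  rw [Measure.integral_comp_mul_left, hgi]
  have h3 : |((2 * Real.pi)⁻¹)⁻¹| * ((2 * Real.pi) ^ (-(1 : ℝ) / 2)) = Real.sqrt (2 * Real.pi) := by
    rw [inv_inv, abs_of_pos (by positivity), Real.sqrt_eq_rpow]
    nth_rw 1 [← Real.rpow_one (2 * Real.pi)]
    rw [← Real.rpow_add (by positivity)]
    norm_num
  rw [← h3]
  simp only [real_smul]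
  push_cast
  ring

/-- The Fourier transform of a superposition of waves `exp(i ξ(p) x)` lives on the range of `ξ`:
after Fubini, Fourier inversion evaluates `φ` at `ξ p`. It serves for `ξ = k₀ sin θ` and `ξ = ±k₀
cosh t`. -/
theorem integral_superposition_mul_schwartzFourier {ν : Measure ℝ} [SFinite ν] {c : ℝ → ℂ}
    {ξ : ℝ → ℝ} (hc : Integrable c ν) (hξ : Measurable ξ) (φ : 𝓢(ℝ, ℂ)) (x' : ℝ) :
    Integrable (fun x => schwartzFourier φ x * ∫ p, c p * cexp (I * (ξ p * (x - x') : ℝ)) ∂ν) ∧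
    ∫ x : ℝ, schwartzFourier φ x * ∫ p, c p * cexp (I * (ξ p * (x - x') : ℝ)) ∂ν =
      (Real.sqrt (2 * Real.pi) : ℂ) * ∫ p, c p * cexp (-(I * (ξ p * x' : ℝ))) * φ (ξ p) ∂ν := by
  have hint : Integrable (fun q : ℝ × ℝ => schwartzFourier φ q.1 *
      (c q.2 * cexp (I * (ξ q.2 * (q.1 - x') : ℝ)))) (volume.prod ν) := by
    have h := ((schwartzFourier φ).integrable (μ := volume)).mul_prod hc
    refine h.mono ?_
      (Eventually.of_forall fun q => ?_)
    · refine ((schwartzFourier φ).continuous.aestronglyMeasurable.comp_fst).mul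
        (hc.aestronglyMeasurable.comp_snd.mul (Measurable.aestronglyMeasurable ?_))
      fun_prop
    · rw [norm_mul, norm_mul, norm_mul, norm_exp_I_mul_ofReal, mul_one]
  constructor
  · have := hint.integral_prod_left
    simpa only [integral_const_mul] using this
  simp_rw [← integral_const_mul]
  rw [integral_integral_swap hint]
  refine integral_congr_ae (Eventually.of_forall fun p => ?_)
  have h1 : ∀ x : ℝ, schwartzFourier φ x * (c p * cexp (I * (ξ p * (x - x') : ℝ))) =
      c p * cexp (-(I * (ξ p * x' : ℝ))) * (schwartzFourier φ x * cexp (I * (ξ p * x : ℝ))) := by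
    intro x
    have : cexp (I * (ξ p * (x - x') : ℝ)) =
        cexp (-(I * (ξ p * x' : ℝ))) * cexp (I * (ξ p * x : ℝ)) := by
      rw [← Complex.exp_add]; congr 1; push_cast; ring
    rw [this]; ring
  simp only [h1]
  rw [integral_const_mul, integral_schwartzFourier_mul_exp]
  ring

theorem kappa_mul_sin {k₀ θ : ℝ} (hk₀ : 0 < k₀) (hθ : 0 ≤ Real.cos θ) :
    kappa k₀ (k₀ * Real.sin θ) = k₀ * Real.cos θ := by
  rw [kappa, show k₀ ^ 2 - (k₀ * Real.sin θ) ^ 2 = (k₀ * Real.cos θ) ^ 2 by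
    have := Real.sin_sq_add_cos_sq θ
    linear_combination k₀ ^ 2 * (-this), Real.sqrt_sq (by positivity)]

theorem image_mul_sin_Ioo {k₀ : ℝ} (hk₀ : 0 < k₀) :
    (fun θ => k₀ * Real.sin θ) '' Ioo (-(Real.pi / 2)) (Real.pi / 2) = Ioo (-k₀) k₀ := by
  ext k
  constructor
  · rintro ⟨θ, hθ, rfl⟩
    have h1 := Real.sin_sq_add_cos_sq θ
    have h2 := Real.cos_pos_of_mem_Ioo hθ
    have h3 : |Real.sin θ| < 1 := by
      rw [← sq_lt_one_iff_abs_lt_one]; nlinarith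
    obtain ⟨h4, h5⟩ := abs_lt.1 h3
    constructor <;> nlinarith
  · rintro ⟨h1, h2⟩
    have h3 : -1 < k / k₀ := by rw [lt_div_iff₀ hk₀]; linarith
    have h4 : k / k₀ < 1 := by rw [div_lt_iff₀ hk₀]; linarith
    refine ⟨Real.arcsin (k / k₀), ⟨Real.neg_pi_div_two_lt_arcsin.2 h3,
      Real.arcsin_lt_pi_div_two.2 h4⟩, ?_⟩
    simp only
    rw [Real.sin_arcsin h3.le h4.le]
    field_simp

/-- The partial Fourier transform of the outgoing fundamental solution along horizontal lines,
tested against functions supported in `(-k₀, k₀)`. -/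
theorem integral_schwartzFourier_mul_outgoingG {k₀ : ℝ} (hk₀ : 0 < k₀) {φ : 𝓢(ℝ, ℂ)}
    (hφ : ∀ k, k ∉ Ioo (-k₀) k₀ → φ k = 0) (rM : ℝ) {r : Plane} (hr : r 1 < rM) :
    ∫ x : ℝ, schwartzFourier φ x * outgoingG k₀ (linePoint rM x - r) =
      I * Real.sqrt (2 * Real.pi) / (4 * Real.pi) *
        ∫ k : ℝ, φ k / kappa k₀ k *
          cexp (I * (kappa k₀ k * (rM - r 1) - k * r 0 : ℝ)) := by
  set y := rM - r 1 with hy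
  have hy0 : 0 < k₀ * y := mul_pos hk₀ (by linarith)
  have hpi := Real.pi_pos
  have h0 : ∀ x, (linePoint rM x - r) 0 = x - r 0 := fun x => by simp [linePoint]
  have h1 : ∀ x, (linePoint rM x - r) 1 = y := fun x => by simp [linePoint, hy]
  have hG : ∀ x : ℝ, outgoingG k₀ (linePoint rM x - r) = I / (4 * Real.pi) *
      ((∫ θ in Ioo (-(Real.pi / 2)) (Real.pi / 2), cexp (I * (k₀ * y * Real.cos θ : ℝ)) *
          cexp (I * (k₀ * Real.sin θ * (x - r 0) : ℝ))) -
        I * ((∫ t in Ioi (0 : ℝ), cexp (-(k₀ * y * Real.sinh t) : ℝ) *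
            cexp (I * (k₀ * Real.cosh t * (x - r 0) : ℝ))) +
          ∫ t in Ioi (0 : ℝ), cexp (-(k₀ * y * Real.sinh t) : ℝ) *
            cexp (I * (-(k₀ * Real.cosh t) * (x - r 0) : ℝ)))) := by
    intro x
    rw [outgoingG_eq hk₀ (by rw [h1]; linarith), h0, h1, propagating, evanescent, evanescent,
      intervalIntegral.integral_of_le (by linarith), integral_Ioc_eq_integral_Ioo]
    congr 2
    · refine integral_congr_ae (Eventually.of_forall fun θ => ?_)
      simp only [← Complex.exp_add]
      congr 1; push_cast; ring
    · congr 2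
      · refine integral_congr_ae (Eventually.of_forall fun t => ?_)
        simp only [← Complex.exp_add]
        congr 1; push_cast; ring
      · refine integral_congr_ae (Eventually.of_forall fun t => ?_)
        simp only [← Complex.exp_add]
        congr 1; push_cast; ring
  have hcp : Integrable (fun θ : ℝ => cexp (I * (k₀ * y * Real.cos θ : ℝ)))
      (volume.restrict (Ioo (-(Real.pi / 2)) (Real.pi / 2))) :=
    (Continuous.integrableOn_Icc (by fun_prop)).mono_set Ioo_subset_Icc_self
  have hce : Integrable (fun t : ℝ => cexp (-(k₀ * y * Real.sinh t) : ℝ))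
      (volume.restrict (Ioi (0 : ℝ))) := by
    have := (integrableOn_exp_neg_sinh hy0).ofReal (𝕜 := ℂ)
    simpa using this
  obtain ⟨i1, e1⟩ := integral_superposition_mul_schwartzFourier hcp
    (ξ := fun θ => k₀ * Real.sin θ) (by fun_prop) φ (r 0)
  obtain ⟨i2, e2⟩ := integral_superposition_mul_schwartzFourier hce
    (ξ := fun t => k₀ * Real.cosh t) (by fun_prop) φ (r 0)
  obtain ⟨i3, e3⟩ := integral_superposition_mul_schwartzFourier hce
    (ξ := fun t => -(k₀ * Real.cosh t)) (by fun_prop) φ (r 0)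
  -- Evanescent frequencies `±k₀ cosh t` lie outside `(-k₀, k₀)`, where `φ` vanishes.
  have hz2 : ∀ t, φ (k₀ * Real.cosh t) = 0 := fun t => hφ _ fun h => by
    have := Real.one_le_cosh t
    nlinarith [h.2]
  have hz3 : ∀ t, φ (-(k₀ * Real.cosh t)) = 0 := fun t => hφ _ fun h => by
    have := Real.one_le_cosh t
    nlinarith [h.1]
  simp only [hz2, mul_zero, integral_zero] at e2
  simp only [hz3, mul_zero, integral_zero] at e3
  have hrw : ∀ x : ℝ, schwartzFourier φ x * outgoingG k₀ (linePoint rM x - r) =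
      I / (4 * Real.pi) *
      (schwartzFourier φ x * (∫ θ in Ioo (-(Real.pi / 2)) (Real.pi / 2),
          cexp (I * (k₀ * y * Real.cos θ : ℝ)) * cexp (I * (k₀ * Real.sin θ * (x - r 0) : ℝ))) -
        I * (schwartzFourier φ x * (∫ t in Ioi (0 : ℝ), cexp (-(k₀ * y * Real.sinh t) : ℝ) *
            cexp (I * (k₀ * Real.cosh t * (x - r 0) : ℝ))) +
          schwartzFourier φ x * ∫ t in Ioi (0 : ℝ), cexp (-(k₀ * y * Real.sinh t) : ℝ) *
            cexp (I * (-(k₀ * Real.cosh t) * (x - r 0) : ℝ)))) := by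
    intro x; rw [hG]; ring
  simp_rw [hrw]
  have i4 := (i2.add i3).const_mul I
  simp only [Pi.add_apply] at i4
  rw [integral_const_mul, integral_sub i1 i4, integral_const_mul,
    integral_add i2 i3, e1, e2, e3]
  -- Substituting `k = k₀ sin θ` gives `κ(k) = k₀ cos θ` and `dk = κ dθ`; this Jacobian is the
  -- source of `1/κ`.
  have hsub : ∫ k : ℝ, φ k / kappa k₀ k * cexp (I * (kappa k₀ k * y - k * r 0 : ℝ)) =
      ∫ θ in Ioo (-(Real.pi / 2)) (Real.pi / 2), cexp (I * (k₀ * y * Real.cos θ : ℝ)) *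
        cexp (-(I * (k₀ * Real.sin θ * r 0 : ℝ))) * φ (k₀ * Real.sin θ) := by
    rw [← setIntegral_eq_integral_of_forall_compl_eq_zero (s := Ioo (-k₀) k₀)
      (fun k hk => by rw [hφ k hk]; simp), ← image_mul_sin_Ioo hk₀,
      integral_image_eq_integral_abs_deriv_smul measurableSet_Ioo
        (fun θ _ => ((Real.hasDerivAt_sin θ).const_mul k₀).hasDerivWithinAt)
        (fun θ hθ θ' hθ' h => Real.injOn_sin (Ioo_subset_Icc_self hθ) (Ioo_subset_Icc_self hθ')
          (mul_left_cancel₀ hk₀.ne' h))]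
    refine setIntegral_congr_fun measurableSet_Ioo fun θ hθ => ?_
    have hcos := Real.cos_pos_of_mem_Ioo hθ
    have hne : ((k₀ * Real.cos θ : ℝ) : ℂ) ≠ 0 := by
      exact_mod_cast (mul_pos hk₀ hcos).ne'
    simp only [kappa_mul_sin hk₀ hcos.le, real_smul]
    rw [abs_of_pos (mul_pos hk₀ hcos), ← Complex.exp_add]
    have : I * ((k₀ * Real.cos θ * y - k₀ * Real.sin θ * r 0 : ℝ) : ℂ) =
        I * (k₀ * y * Real.cos θ : ℝ) + -(I * (k₀ * Real.sin θ * r 0 : ℝ)) := by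
      push_cast; ring
    rw [this]
    field_simp
  rw [hsub]
  ring

/-! ### Incident field, Fourier transform of `f`, and continuity of the right-hand side. -/

instance : IsFiniteMeasure arcLength := by unfold arcLength; infer_instance

theorem integrable_of_memLp_of_ae_eq_zero {f : Plane → ℂ} {rs : ℝ} (hf : MemLp f 2 volume)
    (hsupp : ∀ᵐ r : Plane, r ∉ Metric.ball 0 rs → f r = 0) : Integrable f := by
  have : IsFiniteMeasure (volume.restrict (Metric.ball (0 : Plane) rs)) :=
    isFiniteMeasure_restrict.2 measure_ball_lt_top.ne
  have h : IntegrableOn f (Metric.ball 0 rs) := (hf.restrict _).integrable one_le_two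
  exact h.integrable_of_ae_notMem_eq_zero hsupp

theorem norm_incidentField_le (k₀ : ℝ) (a : Circ → ℂ) (r : Plane) :
    ‖incidentField k₀ a r‖ ≤ ∫ s, ‖a s‖ ∂arcLength := by
  refine (norm_integral_le_integral_norm _).trans_eq (integral_congr_ae
    (Eventually.of_forall fun s => ?_))
  simp only [norm_mul, norm_exp_I_mul_ofReal, mul_one]

theorem continuous_incidentField (k₀ : ℝ) {a : Circ → ℂ} (ha : Integrable a arcLength) :
    Continuous (incidentField k₀ a) := by
  refine continuous_of_dominated (bound := fun s => ‖a s‖) (fun r => ?_)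
    (fun r => Eventually.of_forall fun s => ?_) ha.norm (Eventually.of_forall fun s => ?_)
  · exact ha.aestronglyMeasurable.mul (Continuous.aestronglyMeasurable (by fun_prop))
  · rw [norm_mul, norm_exp_I_mul_ofReal, mul_one]
  · fun_prop

theorem integrable_mul_incidentField (k₀ : ℝ) {f : Plane → ℂ} (hf : Integrable f) {a : Circ → ℂ}
    (ha : Integrable a arcLength) : Integrable fun r => f r * incidentField k₀ a r :=
  hf.mul_bdd (c := ∫ s, ‖a s‖ ∂arcLength)
    (continuous_incidentField k₀ ha).aestronglyMeasurable
    (Eventually.of_forall fun r => norm_incidentField_le k₀ a r)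

theorem norm_fourierFun_integrand {E : Type*} [NormedAddCommGroup E] [InnerProductSpace ℝ E]
    (φ : E → ℂ) (k r : E) : ‖φ r * cexp (-I * (inner ℝ k r : ℝ))‖ = ‖φ r‖ := by
  rw [norm_mul, neg_mul, ← mul_neg, ← ofReal_neg, norm_exp_I_mul_ofReal, mul_one]

theorem norm_fourierFun_le {f : Plane → ℂ} (k : Plane) :
    ‖fourierFun f k‖ ≤ (2 * Real.pi)⁻¹ * ∫ r, ‖f r‖ := by
  have hpi := Real.pi_pos
  rw [fourierFun, norm_mul, norm_real, Real.norm_eq_abs, abs_of_pos (by positivity),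
    finrank_euclideanSpace_fin]
  have : (2 * Real.pi) ^ (-((2 : ℕ) : ℝ) / 2) = (2 * Real.pi)⁻¹ := by
    rw [← Real.rpow_neg_one]; norm_num
  rw [this]
  gcongr
  refine (norm_integral_le_integral_norm _).trans_eq (integral_congr_ae
    (Eventually.of_forall fun s => ?_))
  exact norm_fourierFun_integrand f k s

theorem integral_eq_fourierFun (f : Plane → ℂ) (k : Plane) :
    ∫ r : Plane, f r * cexp (-I * (inner ℝ k r : ℝ)) = 2 * Real.pi * fourierFun f k := by
  have hpi : (Real.pi : ℂ) ≠ 0 := by exact_mod_cast Real.pi_ne_zero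
  rw [fourierFun, finrank_euclideanSpace_fin]
  have : (2 * Real.pi) ^ (-((2 : ℕ) : ℝ) / 2) = (2 * Real.pi)⁻¹ := by
    rw [← Real.rpow_neg_one]; norm_num
  rw [this]
  push_cast
  field_simp

theorem continuous_fourierFun {f : Plane → ℂ} (hf : Integrable f) : Continuous (fourierFun f) := by
  refine Continuous.mul continuous_const ?_
  refine continuous_of_dominated (bound := fun r => ‖f r‖) (fun k => ?_)
    (fun k => Eventually.of_forall fun r => ?_) hf.norm (Eventually.of_forall fun r => ?_)
  · exact hf.aestronglyMeasurable.mul (Continuous.aestronglyMeasurable (by fun_prop))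
  · exact (norm_fourierFun_integrand f k r).le
  · fun_prop

theorem continuous_kappa (k₀ : ℝ) : Continuous (kappa k₀) := by
  unfold kappa; fun_prop

theorem kappa_pos {k₀ k : ℝ} (hk : k ∈ Ioo (-k₀) k₀) : 0 < kappa k₀ k :=
  Real.sqrt_pos.2 (by nlinarith [hk.1, hk.2])

theorem continuous_waveVector (k₀ : ℝ) : Continuous (waveVector k₀) := by
  unfold waveVector
  refine (PiLp.continuous_toLp 2 _).comp (continuous_pi fun i => ?_)
  fin_cases i
  · exact continuous_id
  · exact continuous_kappa k₀

theorem continuous_linePoint (rM : ℝ) : Continuous (linePoint rM) := by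
  unfold linePoint
  refine (PiLp.continuous_toLp 2 _).comp (continuous_pi fun i => ?_)
  fin_cases i
  · exact continuous_id
  · exact continuous_const

theorem continuousOn_diffractionData (k₀ rM : ℝ) {f : Plane → ℂ} (hf : Integrable f)
    {a : Circ → ℂ} (ha : Integrable a arcLength) :
    ContinuousOn (diffractionData k₀ rM f a) (Ioo (-k₀) k₀) := by
  have hκ := continuous_kappa k₀
  have hF := continuous_fourierFun hf
  have hw := continuous_waveVector k₀
  have h1 : Continuous fun k => ∫ s : Circ, a s *
      fourierFun f (waveVector k₀ k - k₀ • (s : Plane)) ∂arcLength := by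
    refine continuous_of_dominated (bound := fun s => ‖a s‖ * ((2 * Real.pi)⁻¹ * ∫ r, ‖f r‖))
      (fun k => ?_) (fun k => Eventually.of_forall fun s => ?_) (ha.norm.mul_const _)
      (Eventually.of_forall fun s => ?_)
    · exact ha.aestronglyMeasurable.mul (Continuous.aestronglyMeasurable (by fun_prop))
    · rw [norm_mul]
      gcongr
      exact norm_fourierFun_le _
    · fun_prop
  refine ContinuousOn.mul (ContinuousOn.mul continuousOn_const (ContinuousOn.div
    (Continuous.continuousOn (by fun_prop)) (Continuous.continuousOn (by fun_prop))
    fun k hk => ?_)) h1.continuousOn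
  exact_mod_cast (kappa_pos hk).ne'

/-- By Fubini, the plane wave in direction `s` shifts the frequency by `k₀ s`; the factor `2π`
undoes the normalization of `fourierFun`. -/
theorem integral_mul_incidentField_mul_exp (k₀ : ℝ) {f : Plane → ℂ} (hf : Integrable f)
    {a : Circ → ℂ} (ha : Integrable a arcLength) (h : Plane) :
    ∫ r : Plane, f r * incidentField k₀ a r * cexp (-I * (inner ℝ h r : ℝ)) =
      2 * Real.pi * ∫ s : Circ, a s * fourierFun f (h - k₀ • (s : Plane)) ∂arcLength := by
  have hint : Integrable (fun p : Plane × Circ => f p.1 * cexp (-I * (inner ℝ h p.1 : ℝ)) *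
      (a p.2 * cexp (I * (k₀ * inner ℝ p.1 (p.2 : Plane) : ℝ)))) (volume.prod arcLength) := by
    refine (hf.mul_prod ha).mono ?_ (Eventually.of_forall fun p => ?_)
    · exact ((hf.aestronglyMeasurable.comp_fst).mul
        (Continuous.aestronglyMeasurable (by fun_prop))).mul
        (ha.aestronglyMeasurable.comp_snd.mul (Continuous.aestronglyMeasurable (by fun_prop)))
    · rw [norm_mul, norm_fourierFun_integrand, norm_mul, norm_exp_I_mul_ofReal, mul_one, norm_mul]
  have h1 : ∀ r : Plane, f r * incidentField k₀ a r * cexp (-I * (inner ℝ h r : ℝ)) =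
      ∫ s : Circ, f r * cexp (-I * (inner ℝ h r : ℝ)) *
        (a s * cexp (I * (k₀ * inner ℝ r (s : Plane) : ℝ))) ∂arcLength := fun r => by
    rw [integral_const_mul, incidentField]; ring
  simp_rw [h1]
  rw [integral_integral_swap hint, ← integral_const_mul]
  refine integral_congr_ae (Eventually.of_forall fun s => ?_)
  simp only
  rw [show 2 * (Real.pi : ℂ) * (a s * fourierFun f (h - k₀ • (s : Plane))) =
    a s * (2 * Real.pi * fourierFun f (h - k₀ • (s : Plane))) by ring, ← integral_eq_fourierFun,
    ← integral_const_mul]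
  refine integral_congr_ae (Eventually.of_forall fun r => ?_)
  simp only
  have : cexp (-I * (inner ℝ (h - k₀ • (s : Plane)) r : ℝ)) =
      cexp (-I * (inner ℝ h r : ℝ)) * cexp (I * (k₀ * inner ℝ r (s : Plane) : ℝ)) := by
    rw [← Complex.exp_add, inner_sub_left, inner_smul_left, real_inner_comm (s : Plane) r]
    congr 1
    simp
    ring
  rw [this]
  ring

/-! ### The Born field on the measurement line. -/

theorem aestronglyMeasurable_bornIntegrand_prod (k₀ rM : ℝ) {f : Plane → ℂ} (hf : Integrable f)
    {a : Circ → ℂ} (ha : Integrable a arcLength) :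
    AEStronglyMeasurable (fun p : ℝ × Plane => bornIntegrand k₀ f a (linePoint rM p.1) p.2)
      (volume.prod volume) := by
  have hl := continuous_linePoint rM
  have hG : AEStronglyMeasurable (fun p : ℝ × Plane => outgoingG k₀ (linePoint rM p.1 - p.2))
      (volume.prod volume) :=
    ((measurable_outgoingG k₀).comp (Continuous.measurable (by fun_prop))).aestronglyMeasurable
  exact (hG.mul hf.aestronglyMeasurable.comp_snd).mul
    ((continuous_incidentField k₀ ha).comp continuous_snd).aestronglyMeasurable

/-- Of the support condition, the estimates and Weyl's formula need only that the sources lie below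
the height `rs`. -/
theorem ae_eq_zero_or_lt {f : Plane → ℂ} {rs : ℝ}
    (hsupp : ∀ᵐ r : Plane, r ∉ Metric.ball 0 rs → f r = 0) :
    ∀ᵐ r : Plane, f r = 0 ∨ r 1 < rs := by
  filter_upwards [hsupp] with r hr
  by_cases h : r ∈ Metric.ball 0 rs
  · right
    have h1 : ‖r 1‖ ≤ ‖r‖ := PiLp.norm_apply_le r 1
    have h2 : ‖r‖ < rs := mem_ball_zero_iff.1 h
    exact (le_abs_self _).trans_lt (h1.trans_lt h2)
  · exact Or.inl (hr h)

/-- A uniform bound for the fundamental solution between the support disk and the measurement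
line. -/
theorem exists_norm_bornIntegrand_le {k₀ rs rM : ℝ} (hk₀ : 0 < k₀) (hrM : rs < rM)
    (f : Plane → ℂ) (a : Circ → ℂ) : ∃ C : ℝ, ∀ x : ℝ, ∀ r : Plane, (f r = 0 ∨ r 1 < rs) →
      ‖bornIntegrand k₀ f a (linePoint rM x) r‖ ≤ C * ‖f r * incidentField k₀ a r‖ := by
  refine ⟨(4 * Real.pi)⁻¹ * (Real.pi + (sinhLaplace (k₀ * (rM - rs)) +
    sinhLaplace (k₀ * (rM - rs)))), fun x r hr => ?_⟩
  rcases hr with hr | hr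
  · simp [bornIntegrand, hr]
  · rw [bornIntegrand, mul_assoc, norm_mul]
    gcongr
    refine norm_outgoingG_le hk₀ (by linarith) ?_
    simp [linePoint]
    linarith

theorem integrable_bornIntegrand {k₀ rs rM : ℝ} (hk₀ : 0 < k₀) (hrM : rs < rM)
    {f : Plane → ℂ} (hf : Integrable f) (hz : ∀ᵐ r : Plane, f r = 0 ∨ r 1 < rs)
    {a : Circ → ℂ} (ha : Integrable a arcLength) (x : ℝ) :
    Integrable (bornIntegrand k₀ f a (linePoint rM x)) := by
  obtain ⟨C, hC⟩ := exists_norm_bornIntegrand_le hk₀ hrM f a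
  refine Integrable.mono' ((integrable_mul_incidentField k₀ hf ha).norm.const_mul C) ?_ ?_
  · exact (((measurable_outgoingG k₀).comp (by fun_prop)).aestronglyMeasurable.mul
      hf.aestronglyMeasurable).mul (continuous_incidentField k₀ ha).aestronglyMeasurable
  · filter_upwards [hz] with r hr using hC x r hr

theorem memLp_bornField {k₀ rs rM : ℝ} (hk₀ : 0 < k₀) (hrM : rs < rM)
    {f : Plane → ℂ} (hf : Integrable f) (hz : ∀ᵐ r : Plane, f r = 0 ∨ r 1 < rs)
    {a : Circ → ℂ} (ha : Integrable a arcLength) :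
    MemLp (fun x : ℝ => bornField k₀ f a (linePoint rM x)) ∞ volume := by
  obtain ⟨C, hC⟩ := exists_norm_bornIntegrand_le hk₀ hrM f a
  refine memLp_top_of_bound
    (aestronglyMeasurable_bornIntegrand_prod k₀ rM hf ha).integral_prod_right'
    (∫ r, C * ‖f r * incidentField k₀ a r‖) (Eventually.of_forall fun x => ?_)
  refine norm_integral_le_of_norm_le ((integrable_mul_incidentField k₀ hf ha).norm.const_mul C) ?_
  filter_upwards [hz] with r hr using hC x r hr

theorem integral_schwartzFourier_mul_bornField {k₀ rs rM : ℝ} (hk₀ : 0 < k₀) (hrM : rs < rM)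
    {f : Plane → ℂ} (hf : Integrable f) (hz : ∀ᵐ r : Plane, f r = 0 ∨ r 1 < rs)
    {a : Circ → ℂ} (ha : Integrable a arcLength) {φ : 𝓢(ℝ, ℂ)}
    (hφc : HasCompactSupport (φ : ℝ → ℂ)) (hφ : tsupport (φ : ℝ → ℂ) ⊆ Ioo (-k₀) k₀) :
    ∫ x : ℝ, schwartzFourier φ x * bornField k₀ f a (linePoint rM x) =
      ∫ k : ℝ, diffractionData k₀ rM f a k * φ k := by
  have hφ0 : ∀ k, k ∉ Ioo (-k₀) k₀ → φ k = 0 := fun k hk =>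
    image_eq_zero_of_notMem_tsupport fun h => hk (hφ h)
  have hκ := continuous_kappa k₀
  have hF := integrable_mul_incidentField k₀ hf ha
  obtain ⟨C, hC⟩ := exists_norm_bornIntegrand_le hk₀ hrM f a
  have hint1 : Integrable (fun p : ℝ × Plane => schwartzFourier φ p.1 *
      bornIntegrand k₀ f a (linePoint rM p.1) p.2) (volume.prod volume) := by
    refine Integrable.mono' ((((schwartzFourier φ).integrable (μ := volume)).mul_prod
      hF).norm.const_mul C) ?_ ?_
    · exact ((schwartzFourier φ).continuous.aestronglyMeasurable.comp_fst).mul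
        (aestronglyMeasurable_bornIntegrand_prod k₀ rM hf ha)
    · filter_upwards [Measure.quasiMeasurePreserving_snd.ae hz] with p hp
      rw [norm_mul, norm_mul]
      calc _ ≤ ‖schwartzFourier φ p.1‖ * (C * ‖f p.2 * incidentField k₀ a p.2‖) := by
            gcongr; exact hC _ _ hp
        _ = _ := by ring
  -- `1/κ` blows up at `±k₀`, but the compact support of `φ` stays inside the open interval.
  have hdiv : Integrable (fun k => φ k / (kappa k₀ k : ℂ)) := by
    refine (integrableOn_iff_integrable_of_support_subset (s := tsupport (φ : ℝ → ℂ))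
      fun k hk => subset_tsupport _ fun h => hk (by simp [h])).1 ?_
    refine ContinuousOn.integrableOn_compact hφc (ContinuousOn.div φ.continuous.continuousOn
      (Continuous.continuousOn (by fun_prop)) fun k hk => ?_)
    exact_mod_cast (kappa_pos (hφ hk)).ne'
  have hint2 : Integrable (fun p : Plane × ℝ => f p.1 * incidentField k₀ a p.1 *
      (φ p.2 / kappa k₀ p.2 * cexp (I * (kappa k₀ p.2 * (rM - p.1 1) - p.2 * p.1 0 : ℝ))))
      (volume.prod volume) := by
    refine (hF.mul_prod hdiv).mono ?_ (Eventually.of_forall fun p => ?_)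
    · exact hF.aestronglyMeasurable.comp_fst.mul (hdiv.aestronglyMeasurable.comp_snd.mul
        (Continuous.aestronglyMeasurable (by fun_prop)))
    · simp only [norm_mul, norm_exp_I_mul_ofReal, mul_one, le_refl]
  have hstep : ∀ᵐ r : Plane, (∫ x : ℝ, schwartzFourier φ x *
      bornIntegrand k₀ f a (linePoint rM x) r) =
      I * Real.sqrt (2 * Real.pi) / (4 * Real.pi) * ∫ k : ℝ, f r * incidentField k₀ a r *
        (φ k / kappa k₀ k * cexp (I * (kappa k₀ k * (rM - r 1) - k * r 0 : ℝ))) := by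
    filter_upwards [hz] with r hr
    rcases hr with hr | hr
    · simp [bornIntegrand, hr]
    · have h1 : ∀ x : ℝ, schwartzFourier φ x * bornIntegrand k₀ f a (linePoint rM x) r =
          f r * incidentField k₀ a r *
            (schwartzFourier φ x * outgoingG k₀ (linePoint rM x - r)) := fun x => by
        rw [bornIntegrand]; ring
      simp_rw [h1]
      rw [integral_const_mul, integral_schwartzFourier_mul_outgoingG hk₀ hφ0 rM (hr.trans hrM),
        integral_const_mul]
      ring
  have hwave : ∀ (k : ℝ) (r : Plane), cexp (I * (kappa k₀ k * (rM - r 1) - k * r 0 : ℝ)) =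
      cexp (I * (kappa k₀ k * rM : ℝ)) * cexp (-I * (inner ℝ (waveVector k₀ k) r : ℝ)) := by
    intro k r
    rw [← Complex.exp_add]
    have : inner ℝ (waveVector k₀ k) r = k * r 0 + kappa k₀ k * r 1 := by
      rw [PiLp.inner_apply, Fin.sum_univ_two]
      simp [waveVector]
      ring
    rw [this]
    congr 1
    push_cast
    ring
  -- Needed for the constant: `i√(2π)/(4π)` from `G` times `2π` from the Fourier transform equals
  -- `i√(π/2)`.
  have hsqrt : Real.sqrt (2 * Real.pi) = 2 * Real.sqrt (Real.pi / 2) := by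
    rw [show 2 * Real.pi = 2 ^ 2 * (Real.pi / 2) by ring, Real.sqrt_mul (by positivity),
      Real.sqrt_sq (by positivity)]
  have hpi : (Real.pi : ℂ) ≠ 0 := by exact_mod_cast Real.pi_ne_zero
  simp_rw [bornField, ← integral_const_mul]
  rw [integral_integral_swap hint1, integral_congr_ae hstep, integral_const_mul,
    integral_integral_swap hint2, ← integral_const_mul]
  refine integral_congr_ae (Eventually.of_forall fun k => ?_)
  have h2 : ∀ r : Plane, f r * incidentField k₀ a r *
      (φ k / kappa k₀ k * cexp (I * (kappa k₀ k * (rM - r 1) - k * r 0 : ℝ))) =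
      φ k / kappa k₀ k * cexp (I * (kappa k₀ k * rM : ℝ)) *
        (f r * incidentField k₀ a r * cexp (-I * (inner ℝ (waveVector k₀ k) r : ℝ))) := by
    intro r; rw [hwave]; ring
  simp only [h2]
  rw [integral_const_mul, integral_mul_incidentField_mul_exp k₀ hf ha, diffractionData, hsqrt]
  push_cast
  field_simp
  ring

end DiffractionTomography

end

theorem theorem1 (k₀ rs rM : ℝ) (hk₀ : 0 < k₀) (hrM : rs < rM)
    (f : DiffractionTomography.Plane → ℂ) (hf : MemLp f 2 volume)
    (hsupp : ∀ᵐ r : DiffractionTomography.Plane, r ∉ Metric.ball 0 rs → f r = 0)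
    (a : DiffractionTomography.Circ → ℂ) (ha : MemLp a 2 DiffractionTomography.arcLength) :
    (∀ x : ℝ, Integrable (DiffractionTomography.bornIntegrand k₀ f a
      (DiffractionTomography.linePoint rM x))) ∧
    ContinuousOn (DiffractionTomography.diffractionData k₀ rM f a) (Set.Ioo (-k₀) k₀) ∧
    ∃ hv : MemLp (fun x : ℝ => DiffractionTomography.bornField k₀ f a
        (DiffractionTomography.linePoint rM x)) ∞ volume,
      DiffractionTomography.EqFunOn
        (DiffractionTomography.distFourier (Lp.toTemperedDistribution hv.toLp))
        (DiffractionTomography.diffractionData k₀ rM f a)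
        (Set.Ioo (-k₀) k₀) := by
  -- The disk and the circle have finite measure, so `f` and `a` are integrable; only this is used
  -- of their square integrability.
  have hfi := DiffractionTomography.integrable_of_memLp_of_ae_eq_zero hf hsupp
  have hz := DiffractionTomography.ae_eq_zero_or_lt hsupp
  have hai : Integrable a DiffractionTomography.arcLength := ha.integrable one_le_two
  have hcont := DiffractionTomography.continuousOn_diffractionData k₀ rM hfi hai
  refine ⟨DiffractionTomography.integrable_bornIntegrand hk₀ hrM hfi hz hai, hcont,
    DiffractionTomography.memLp_bornField hk₀ hrM hfi hz hai,
    hcont.locallyIntegrableOn measurableSet_Ioo, fun φ hφc hφ => ?_⟩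
  rw [DiffractionTomography.distFourier_apply, Lp.toTemperedDistribution_apply,
    ← DiffractionTomography.integral_schwartzFourier_mul_bornField hk₀ hrM hfi hz hai hφc hφ]
  refine integral_congr_ae ?_
  filter_upwards [(DiffractionTomography.memLp_bornField hk₀ hrM hfi hz hai).coeFn_toLp] with x hx
  rw [hx, smul_eq_mul]
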